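/- **Setting.** A *ray space* $(X,d,d_L)$ is a Polish metric space $(X,d)$ with a distance $d_L:X\times X\to[0,+\infty]$ that is lower semicontinuous on $(X\times X,d\times d)$, satisfies $d_L\ge d$, and is such that: any two points at finite $d_L$-distance are joined by a $d_L$-geodesic (a curve $\gamma:[0,1]\to X$ with $d_L(\gamma(s),\gamma(t))=|s-t|\,d_L(\gamma(0),\gamma(1))<\infty$); geodesics do not branch (two geodesics that agree on $[0,s]$, $0<s<1$, agree); geodesics are locally compact (if $\gamma$ is defined on an interval $I$ with $d_L(\gamma(s),\gamma(t))=|s-t|$, then each $t\in I$ has an $r>0$ such that $\{s\in I: d(\gamma(s),\gamma(t))\le r\}$ is compact); and, if $K_1,K_2$ are $d$-compact and $d_L$ is bounded on $K_1\times K_2$, the union of all geodesics from points of $K_1$ to points of $K_2$ is $d$-compact. Let $\pi$ be a Borel probability measure on $X\times X$. A *monotone carrier* of $\pi$ is a $d_L$-cyclically monotone set $\Gamma\subset\{d_L<\infty\}$ with $\pi(\Gamma)=1$ that is an increasing countable union of compact sets on each of which $d_L$ is continuous. For such a $\Gamma$ let $\Gamma'$ be the set of pairs $(w_0,z_I)$,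 for $I\ge 0$ and $(w_i,z_i)\in\Gamma$, $0\le i\le I$, such that $\sum_{i=0}^I d_L(w_{i+1},z_i)=\sum_{i=0}^I d_L(w_i,z_i)$, where $w_{I+1}=w_0$. Let $$G=\{(x,y):\exists (w,z)\in\Gamma',\ d_L(w,x)+d_L(x,y)+d_L(y,z)=d_L(w,z)\},\qquad R=G\cup G^{-1},$$ let $\mathcal T_e$ be the set of the $x$ for which there is $w\ne x$ with $(w,x)\in G$ or there is $z\neq x$ with $(x,z)\in G$, and let $\mathcal T$ be the set of the $x$ for which both exist. Let $f$ be a cross section of the equivalence relation $R$ on $\mathcal T$, that is, $f:\mathcal T\to\mathcal T$ is constant on the classes and $(x,f(x))\in R$. For $y\in f(\mathcal T)$ let $g(y,t)$ be the point $x$ with $d_L(x,y)=|t|$ and $(y,x)\in G$ if $t\ge0$, $(x,y)\in G$ if $t<0$ (where it exists). For $A\subset\mathcal T_e$ put $A_t=g(g^{-1}(A)+(0,t))$. A probability measure $\mu$ on $X$ satisfies the *absolute continuity assumption* along the rays of $\Gamma$ if, for every Borel set $A\subset\mathcal T_e$, $$\mu(A)>0\ \Longrightarrow\ \int_0^{+\infty}\mu(A_t)\,dt>0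 .$$ **Theorem.** Let $(X,d,d_L)$ and $(X_n,d_n,d_{L,n})$, $n\in\mathbb N$, be ray spaces, let $\pi$ be a Borel probability measure on $X\times X$ and let $\pi_n$ be Borel probability measures on $X_n\times X_n$ whose first and second marginals $\mu_n,\nu_n$ are mutually singular. Let $\Gamma_n$ be a monotone carrier of $\pi_n$ and let $f_n$ be a $\mu_n$-measurable cross section of its rays. Assume the following. 1. *Convergence.* There is $C$ with $\int d_{L,n}\,d\pi_n\le C$ for all $n$, and there are Borel sets $A_n\subset X_n$ and Borel maps $\ell_n:A_n\to X$ such that $(\ell_n\otimes\ell_n)_\sharp(\pi_n\llcorner_{A_n\times A_n})\rightharpoonup\pi$ weakly; $|d_L(\ell_n(x),\ell_n(y))-d_{L,n}(x,y)|\le 2^{-n}$ for $x,y\in A_n$ (in particular, one distance is infinite if and only if the other is); and $d_{L,n}(x_n,y_n)\to d_L(x,y)$ whenever $x_n,y_n\in A_n$ for all large $n$ and $(\ell_n(x_n),\ell_n(y_n))\to(x,y)$ in $(X\times X,d\times d)$. 2. Each $\mu_n$ satisfies the absolute continuity assumption along the rays of $\Gamma_n$. Then, with $m_n=(f_n)_\sharp\mu_n$,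 one has $\mu_n=(g_n)_\sharp(r_n\,m_n\otimes\mathcal L^1)$ for a unique $r_n\in L^1(m_n\otimes\mathcal L^1)$, $r_n\geq 0$, namely the density with respect to $m_n\otimes\mathcal L^1$ of the image of $\mu_n$ under the inverse of the ray map $g_n$. 3. The densities $r_n$ are equi-integrable: for every $\varepsilon>0$ there is $\delta>0$ such that, for every $n$ and every Borel set $A\subset X_n\times\mathbb R$, $(m_n\otimes\mathcal L^1)(A)<\delta$ implies $\int_A r_n\,d(m_n\otimes\mathcal L^1)<\varepsilon$. Then $\pi$ has a monotone carrier contained in $\operatorname{supp}\pi$, and the first marginal $\mu$ of $\pi$ satisfies the absolute continuity assumption along the rays of every monotone carrier $\Gamma$ of $\pi$ with $\Gamma\subset\operatorname{supp}\pi$. If $\pi(\{x=y\})=0$, it does so along the rays of every monotone carrier $\Gamma$ of $\pi$. -/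

import Mathlib

open Set Filter Topology MeasureTheory
open scoped ENNReal NNReal BoundedContinuousFunction

noncomputable section

namespace RayTransport

/-! ## The metric structures `(X, d, d_L)` -/

section Geodesics

variable {X : Type*}

/-- `γ` restricted to `[0,1]` is a minimizing `d_L`-geodesic from `x` to `y` (a curve of finite
length `d_L x y`), parametrized with constant speed. -/
def IsGeodesic (dL : X → X → ℝ≥0∞) (γ : ℝ → X) (x y : X) : Prop :=
  γ 0 = x ∧ γ 1 = y ∧ dL x y ≠ ⊤ ∧
    ∀ s ∈ Icc (0 : ℝ) 1, ∀ t ∈ Icc (0 : ℝ) 1,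
      dL (γ s) (γ t) = ENNReal.ofReal |s - t| * dL x y

/-- The union of the geodesics `γ_{[x,y]}` with `x ∈ K₁` and `y ∈ K₂`. -/
def geodesicHull (dL : X → X → ℝ≥0∞) (K₁ K₂ : Set X) : Set X :=
  {z | ∃ x ∈ K₁, ∃ y ∈ K₂, ∃ γ : ℝ → X, IsGeodesic dL γ x y ∧ ∃ s ∈ Icc (0 : ℝ) 1, γ s = z}

/-- The standing assumptions on `(X, d, d_L)`, where `d` is the metric of `X`: `d_L` is an extended
distance, lower semicontinuous with respect to `d` and not smaller than `d`, and `(X, d_L)` is a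
non-branching geodesic space satisfying two compactness properties. (It follows that `d_L` is Borel
and that the geodesics are `d`-continuous.) -/
structure IsRaySpace [MetricSpace X] (dL : X → X → ℝ≥0∞) : Prop where
  eq_zero_iff : ∀ x y, dL x y = 0 ↔ x = y
  symm : ∀ x y, dL x y = dL y x
  triangle : ∀ x y z, dL x z ≤ dL x y + dL y z
  lowerSemicontinuous : LowerSemicontinuous (fun p : X × X => dL p.1 p.2)
  edist_le : ∀ x y, edist x y ≤ dL x y
  /-- Points at finite distance are joined by a geodesic. -/
  exists_geodesic : ∀ x y, dL x y ≠ ⊤ → ∃ γ : ℝ → X, IsGeodesic dL γ x y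
  /-- Geodesics do not bifurcate. -/
  nonbranching : ∀ (γ₁ γ₂ : ℝ → X) (x y₁ y₂ : X),
    IsGeodesic dL γ₁ x y₁ → IsGeodesic dL γ₂ x y₂ →
    ∀ s ∈ Ioo (0 : ℝ) 1, EqOn γ₁ γ₂ (Icc 0 s) → EqOn γ₁ γ₂ (Icc 0 1)
  /-- Geodesics, parametrized by `d_L`-length on an arbitrary interval `I`, are locally compact. -/
  geodesic_locallyCompact : ∀ (I : Set ℝ) (γ : ℝ → X), I.OrdConnected →
    (∀ s ∈ I, ∀ t ∈ I, dL (γ s) (γ t) = ENNReal.ofReal |s - t|) →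
    ∀ t ∈ I, ∃ r > 0, IsCompact {s | s ∈ I ∧ dist (γ s) (γ t) ≤ r}
  /-- The geodesics between two compact sets at bounded distance fill a compact set. -/
  isCompact_geodesicHull : ∀ K₁ K₂ : Set X, IsCompact K₁ → IsCompact K₂ →
    (∃ M : ℝ≥0, ∀ x ∈ K₁, ∀ y ∈ K₂, dL x y ≤ M) → IsCompact (geodesicHull dL K₁ K₂)

end Geodesics

/-! ## Cyclical monotonicity and transport rays -/

section Rays

variable {X : Type*}

/-- `Γ` is `c`-cyclically monotone. The indices are cyclic: in `Fin (n + 1)`, the successor of the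
last index is `0`. -/
def IsCyclicallyMonotone (c : X → X → ℝ≥0∞) (Γ : Set (X × X)) : Prop :=
  ∀ (n : ℕ) (x y : Fin (n + 1) → X), (∀ i, (x i, y i) ∈ Γ) →
    ∑ i, c (x i) (y i) ≤ ∑ i, c (x (i + 1)) (y i)

/-- The plan `π` is concentrated on the `d_L`-cyclically monotone set `Γ`, on which `d_L` is finite
and which is an increasing union of compact sets on each of which `d_L` is continuous. -/
structure IsMonotoneCarrier [TopologicalSpace X] [MeasurableSpace X] (dL : X → X → ℝ≥0∞)
    (π : Measure (X × X)) (Γ : Set (X × X)) : Prop where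
  monotone : IsCyclicallyMonotone dL Γ
  finite : ∀ p ∈ Γ, dL p.1 p.2 ≠ ⊤
  exhaustion : ∃ K : ℕ → Set (X × X), Monotone K ∧ (∀ k, IsCompact (K k)) ∧
    (∀ k, ContinuousOn (fun p : X × X => dL p.1 p.2) (K k)) ∧ Γ = ⋃ k, K k
  concentrated : π Γᶜ = 0

/-- The set `Γ'`: pairs `(x, y)` that are the first source and the last target of a closed cycle
in `Γ` of total cost `0`. -/
def cycleSet (dL : X → X → ℝ≥0∞) (Γ : Set (X × X)) : Set (X × X) :=
  {p | ∃ (I : ℕ) (w z : Fin (I + 1) → X), (∀ i, (w i, z i) ∈ Γ) ∧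
    w 0 = p.1 ∧ z (Fin.last I) = p.2 ∧
    ∑ i, dL (w (i + 1)) (z i) = ∑ i, dL (w i) (z i)}

/-- The set `G` of oriented transport rays. -/
def orientedRays (dL : X → X → ℝ≥0∞) (Γ : Set (X × X)) : Set (X × X) :=
  {p | ∃ q ∈ cycleSet dL Γ, dL q.1 p.1 + dL p.1 p.2 + dL p.2 q.2 = dL q.1 q.2}

/-- The set `R = G ∪ G⁻¹` of transport rays. -/
def rays (dL : X → X → ℝ≥0∞) (Γ : Set (X × X)) : Set (X × X) :=
  {p | p ∈ orientedRays dL Γ ∨ p.swap ∈ orientedRays dL Γ}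

/-- The transport set without end points, `𝒯`. -/
def transportSet (dL : X → X → ℝ≥0∞) (Γ : Set (X × X)) : Set X :=
  {x | (∃ w, w ≠ x ∧ (w, x) ∈ orientedRays dL Γ) ∧ ∃ z, z ≠ x ∧ (x, z) ∈ orientedRays dL Γ}

/-- The transport set with end points, `𝒯ₑ`. -/
def transportSetE (dL : X → X → ℝ≥0∞) (Γ : Set (X × X)) : Set X :=
  {x | (∃ w, w ≠ x ∧ (w, x) ∈ orientedRays dL Γ) ∨ ∃ z, z ≠ x ∧ (x, z) ∈ orientedRays dL Γ}

/-- `f` is a cross section (quotient map) of the equivalence relation `R` on `𝒯`. -/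
structure IsCrossSection (dL : X → X → ℝ≥0∞) (Γ : Set (X × X)) (f : X → X) : Prop where
  mapsTo : MapsTo f (transportSet dL Γ) (transportSet dL Γ)
  rel : ∀ x ∈ transportSet dL Γ, (x, f x) ∈ rays dL Γ
  eq_of_rel : ∀ x ∈ transportSet dL Γ, ∀ x' ∈ transportSet dL Γ,
    (x, x') ∈ rays dL Γ → f x = f x'

/-- The graph of the ray map `g`: the triples `(y, t, x)` such that `x` is the point of the ray of
`y ∈ 𝒮 = f(𝒯)` at signed `d_L`-distance `t` from `y`. -/
def rayGraph (dL : X → X → ℝ≥0∞) (Γ : Set (X × X)) (f : X → X) : Set (X × ℝ × X) :=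
  {p | p.1 ∈ f '' transportSet dL Γ ∧
    ((0 ≤ p.2.1 ∧ (p.1, p.2.2) ∈ orientedRays dL Γ ∧
        dL p.2.2 p.1 = ENNReal.ofReal p.2.1) ∨
     (p.2.1 < 0 ∧ (p.2.2, p.1) ∈ orientedRays dL Γ ∧
        dL p.2.2 p.1 = ENNReal.ofReal (-p.2.1)))}

/-- The translate `A_t = g (g⁻¹(A) + (0, t))` of `A` along the rays. -/
def translate (dL : X → X → ℝ≥0∞) (Γ : Set (X × X)) (f : X → X) (A : Set X) (t : ℝ) : Set X :=
  {z | ∃ (y : X) (τ : ℝ) (x : X), x ∈ A ∧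
    (y, τ, x) ∈ rayGraph dL Γ f ∧ (y, τ + t, z) ∈ rayGraph dL Γ f}

/-- The absolute continuity assumption on `μ`: a Borel set `A ⊆ 𝒯ₑ` of positive measure satisfies
`∫₀^∞ μ(A_t) dt > 0`. -/
def AbsContAlongRays [MeasurableSpace X] (dL : X → X → ℝ≥0∞) (Γ : Set (X × X)) (f : X → X)
    (μ : Measure X) : Prop :=
  ∀ A : Set X, MeasurableSet A → A ⊆ transportSetE dL Γ → 0 < μ A →
    0 < ∫⁻ t in Ioi (0 : ℝ), μ (translate dL Γ f A t)

open Classical in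
/-- The inverse of the ray map on `𝒯`: the point `f x` and the signed `d_L`-distance of `x` from
it. -/
def rayCoord (dL : X → X → ℝ≥0∞) (Γ : Set (X × X)) (f : X → X) (x : X) : X × ℝ :=
  (f x, if (f x, x) ∈ orientedRays dL Γ then (dL x (f x)).toReal else -(dL x (f x)).toReal)

/-- The quotient measure `m = f_♯ (μ ⌞ 𝒯)`. -/
def quotientMeasure [MeasurableSpace X] (dL : X → X → ℝ≥0∞) (Γ : Set (X × X)) (f : X → X)
    (μ : Measure X) : Measure X :=
  (μ.restrict (transportSet dL Γ)).map f

/-- The measure `m ⊗ ℒ¹`. -/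
def rayReference [MeasurableSpace X] (dL : X → X → ℝ≥0∞) (Γ : Set (X × X)) (f : X → X)
    (μ : Measure X) : Measure (X × ℝ) :=
  (quotientMeasure dL Γ f μ).prod volume

/-- The ray density `r` of `μ`, i.e. the function with `μ = g_♯ (r m ⊗ ℒ¹)`: the density with
respect to `m ⊗ ℒ¹` of the image of `μ ⌞ 𝒯` under the inverse of the ray map. -/
def rayDensity [MeasurableSpace X] (dL : X → X → ℝ≥0∞) (Γ : Set (X × X)) (f : X → X)
    (μ : Measure X) : X × ℝ → ℝ≥0∞ :=
  ((μ.restrict (transportSet dL Γ)).map (rayCoord dL Γ f)).rnDeriv (rayReference dL Γ f μ)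

end Rays

/-! ## Sequences of structures -/

section Sequences

variable {Y : ℕ → Type*} [∀ n, MeasurableSpace (Y n)]

/-- The ray densities `r_n` are equi-integrable with respect to the measures `m_n ⊗ ℒ¹`. -/
def EquiIntegrableRayDensities (dLn : ∀ n, Y n → Y n → ℝ≥0∞) (Γn : ∀ n, Set (Y n × Y n))
    (fn : ∀ n, Y n → Y n) (μn : ∀ n, Measure (Y n)) : Prop :=
  ∀ ε : ℝ≥0, 0 < ε → ∃ δ : ℝ≥0, 0 < δ ∧ ∀ n, ∀ A : Set (Y n × ℝ), MeasurableSet A →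
    rayReference (dLn n) (Γn n) (fn n) (μn n) A < δ →
    ∫⁻ p in A, rayDensity (dLn n) (Γn n) (fn n) (μn n) p
      ∂(rayReference (dLn n) (Γn n) (fn n) (μn n)) < ε

/-- Convergence of the structures `(Y n, d_n, d_{L,n}, π_n)` to `(X, d, d_L, π)`. -/
def StructuresConverge {X : Type*} [TopologicalSpace X] [MeasurableSpace X]
    (dLn : ∀ n, Y n → Y n → ℝ≥0∞) (πn : ∀ n, Measure (Y n × Y n))
    (dL : X → X → ℝ≥0∞) (π : Measure (X × X)) : Prop :=
  (∃ C : ℝ≥0, ∀ n, ∫⁻ p, dLn n p.1 p.2 ∂(πn n) ≤ C) ∧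
  ∃ (A : ∀ n, Set (Y n)) (l : ∀ n, Y n → X),
    (∀ n, MeasurableSet (A n)) ∧
    (∀ n, Measurable (fun x : A n => l n x)) ∧
    -- weak convergence of the images of the restricted plans
    (∀ φ : X × X →ᵇ ℝ, Tendsto
      (fun n => ∫ p, φ p ∂(((πn n).restrict (A n ×ˢ A n)).map (Prod.map (l n) (l n))))
      atTop (𝓝 (∫ p, φ p ∂π))) ∧
    -- `|d_L (l x) (l y) - d_{L,n} x y| ≤ 2⁻ⁿ`, for distances with values in `[0, ∞]`
    (∀ n, ∀ x ∈ A n, ∀ y ∈ A n,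
      dL (l n x) (l n y) ≤ dLn n x y + (2 : ℝ≥0∞)⁻¹ ^ n ∧
      dLn n x y ≤ dL (l n x) (l n y) + (2 : ℝ≥0∞)⁻¹ ^ n) ∧
    -- continuity of the distances along converging sequences
    (∀ (u v : ∀ n, Y n) (x y : X), (∀ᶠ n in atTop, u n ∈ A n ∧ v n ∈ A n) →
      Tendsto (fun n => l n (u n)) atTop (𝓝 x) → Tendsto (fun n => l n (v n)) atTop (𝓝 y) →
      Tendsto (fun n => dLn n (u n) (v n)) atTop (𝓝 (dL x y)))

end Sequences

end RayTransport

end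

/-! For `t > 0`, the translate `A_t` consists of the points lying at distance `t` after a point of
`A` on an oriented ray, whatever the cross section (`translate_subset`, `subset_translate`). So the
claim is that the pairs `(y, t)` with `y` reached from `A` in time `t` have positive measure.

On each approximating space, absolute continuity makes `μ_n` concentrated on the rays without end
points, because almost every point is moved and initial points form a null set
(`ae_mem_transportSet`). It also makes the image of `μ_n` in ray coordinates absolutely continuous.
Equi-integrability then says, uniformly in `n`, that a set whose slices along the rays are short has
small measure. Hence, up to measure `ε`, the points `v` of a bounded set `S` have inner distances of
total length more than `η`: times `t` at which some `x ∈ S` precedes `v`, with a further point `p ∈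
S` at least `η` before `x` and a point `q ∈ S` at least `η` after `v`
(`exists_forall_measure_le_add`).

Membership in `G` need not pass to the limit. What does pass is additivity of distances along `p, x,
v, q`, and compatibility of a pair with `Γ ⊆ supp π`, because chains in the support are limits of
chains in `Γ_n` (`exists_seq_chainCost`, `isCompatiblePair_of_tendsto`). If the limit of `x` starts
a ray of `Γ` at least as long as the distance to the limit of `v`, compatibility of the limit of
`(p, x)` makes that ray prolong the segment from `p` to `x`; nonbranching forces the limit of `v`
onto it (`mem_orientedRays_of_forward`). If instead a long ray ends at the limit of `v`, the margin
`q` plays the same role. This is why `p` and `q` are carried along.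

It remains to take a small compact `K ⊆ A` of positive measure with rays of length at least `ρ` on
one side, apply the estimate to the points of the approximating spaces near `K`, and pass to upper
limits of sets. These are closed, lose no mass, and are evaluated by Fubini
(`lintegral_pos_of_isCompact`). Continuity of `d_L` on limit points and inner regularity yield the
carrier in `supp π`. -/

namespace RayTransport

/-! ### Chains of pairs and the set `Γ'`. -/

section Chains

variable {X : Type*}

/-- `ChainCost c Γ w z P Q` : there is a finite chain of pairs `(wᵢ, zᵢ)` in `Γ` with first source
`w` and last target `z`, with `P = ∑ c (wᵢ, zᵢ)` and with `Q = ∑ c (wᵢ₊₁, zᵢ)`, where the latter sum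
does not contain the term that closes the cycle. -/
inductive ChainCost (c : X → X → ℝ≥0∞) (Γ : Set (X × X)) : X → X → ℝ≥0∞ → ℝ≥0∞ → Prop
  | single {w z : X} : (w, z) ∈ Γ → ChainCost c Γ w z (c w z) 0
  | cons {w z w' z' : X} {P Q : ℝ≥0∞} : (w, z) ∈ Γ → ChainCost c Γ w' z' P Q →
      ChainCost c Γ w z' (c w z + P) (c w' z + Q)

variable {c : X → X → ℝ≥0∞} {Γ : Set (X × X)}

/-- The extra term links the last target of the first chain to the first source of the second. Open
chains can thus be glued, and only the closing term changes. -/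
theorem ChainCost.append {w z w' z' : X} {P Q P' Q' : ℝ≥0∞} (h : ChainCost c Γ w z P Q)
    (h' : ChainCost c Γ w' z' P' Q') :
    ChainCost c Γ w z' (P + P') (Q + Q' + c w' z) := by
  induction h with
  | single hm =>
    have := ChainCost.cons hm h'
    simpa [add_comm] using this
  | cons hm _ ih =>
    have := ChainCost.cons hm ih
    simpa [add_assoc] using this

theorem ChainCost.mono {Γ' : Set (X × X)} (hΓ : Γ ⊆ Γ') {w z : X} {P Q : ℝ≥0∞}
    (h : ChainCost c Γ w z P Q) : ChainCost c Γ' w z P Q := by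
  induction h with
  | single hm => exact .single (hΓ hm)
  | cons hm _ ih => exact .cons (hΓ hm) ih

theorem ChainCost.ne_top (hfin : ∀ p ∈ Γ, c p.1 p.2 ≠ ⊤) {w z : X} {P Q : ℝ≥0∞}
    (h : ChainCost c Γ w z P Q) : P ≠ ⊤ := by
  induction h with
  | single hm => exact hfin _ hm
  | cons hm _ ih => exact ENNReal.add_ne_top.2 ⟨hfin _ hm, ih⟩

theorem sum_cyclic_eq {I : ℕ} (w z : Fin (I + 1) → X) :
    ∑ i, c (w (i + 1)) (z i) =
      (∑ i : Fin I, c (w i.succ) (z i.castSucc)) + c (w 0) (z (Fin.last I)) := by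
  rw [Fin.sum_univ_castSucc]
  simp

theorem chainCost_iff {a b : X} {P Q : ℝ≥0∞} :
    ChainCost c Γ a b P Q ↔ ∃ (I : ℕ) (w z : Fin (I + 1) → X), (∀ i, (w i, z i) ∈ Γ) ∧
      w 0 = a ∧ z (Fin.last I) = b ∧ P = ∑ i, c (w i) (z i) ∧
      Q = ∑ i : Fin I, c (w i.succ) (z i.castSucc) := by
  constructor
  · intro h
    induction h with
    | @single w z hm => exact ⟨0, fun _ => w, fun _ => z, fun _ => hm, rfl, rfl, by simp, by simp⟩
    | @cons w z w' z' P Q hm h ih =>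
      obtain ⟨I, ws, zs, hΓ, h0, hl, hP, hQ⟩ := ih
      refine ⟨I + 1, Fin.cons w ws, Fin.cons z zs, ?_, rfl, ?_, ?_, ?_⟩
      · intro i
        refine Fin.cases hm (fun i => ?_) i
        simpa using hΓ i
      · rw [← Fin.succ_last, Fin.cons_succ, hl]
      · rw [Fin.sum_univ_succ, hP]; simp
      · rw [Fin.sum_univ_succ, hQ, ← h0]; simp
  · rintro ⟨I, w, z, hΓ, rfl, rfl, rfl, rfl⟩
    induction I with
    | zero => simpa using ChainCost.single (c := c) (hΓ 0)
    | succ I ih =>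
      have := ih (fun i => w i.succ) (fun i => z i.succ) (fun i => hΓ i.succ)
      have := ChainCost.cons (hΓ 0) this
      rw [Fin.sum_univ_succ (f := fun i => c (w i) (z i)),
        Fin.sum_univ_succ (f := fun i : Fin (I + 1) => c (w i.succ) (z i.castSucc))]
      exact this

theorem isCyclicallyMonotone_iff : IsCyclicallyMonotone c Γ ↔
    ∀ w z P Q, ChainCost c Γ w z P Q → P ≤ Q + c w z := by
  constructor
  · intro h w z P Q hc
    obtain ⟨I, w, z, hΓ, rfl, rfl, rfl, rfl⟩ := chainCost_iff.1 hc
    rw [← sum_cyclic_eq]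
    exact h I w z hΓ
  · intro h I w z hΓ
    rw [sum_cyclic_eq]
    exact h _ _ _ _ (chainCost_iff.2 ⟨I, w, z, hΓ, rfl, rfl, rfl, rfl⟩)

theorem mem_cycleSet_iff {a b : X} : (a, b) ∈ cycleSet c Γ ↔
    ∃ P Q, ChainCost c Γ a b P Q ∧ Q + c a b = P := by
  constructor
  · rintro ⟨I, w, z, hΓ, h0, hl, hs⟩
    dsimp only at h0 hl
    refine ⟨_, _, chainCost_iff.2 ⟨I, w, z, hΓ, h0, hl, rfl, rfl⟩, ?_⟩
    rw [← h0, ← hl, ← sum_cyclic_eq, hs]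
  · rintro ⟨P, Q, hc, hs⟩
    obtain ⟨I, w, z, hΓ, rfl, rfl, rfl, rfl⟩ := chainCost_iff.1 hc
    refine ⟨I, w, z, hΓ, rfl, rfl, ?_⟩
    rw [sum_cyclic_eq, hs]

theorem subset_cycleSet : Γ ⊆ cycleSet c Γ := fun p hp =>
  mem_cycleSet_iff.2 ⟨_, _, .single hp, by simp⟩

theorem cycleSet_mono {Γ' : Set (X × X)} (hΓ : Γ ⊆ Γ') : cycleSet c Γ ⊆ cycleSet c Γ' := by
  rintro ⟨a, b⟩ h
  obtain ⟨P, Q, hc, hs⟩ := mem_cycleSet_iff.1 h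
  exact mem_cycleSet_iff.2 ⟨P, Q, hc.mono hΓ, hs⟩

theorem orientedRays_mono {Γ' : Set (X × X)} (hΓ : Γ ⊆ Γ') :
    orientedRays c Γ ⊆ orientedRays c Γ' := fun _ ⟨q, hq, h⟩ => ⟨q, cycleSet_mono hΓ hq, h⟩

end Chains

/-! ### Geodesics: intermediate points, concatenation, nonbranching. -/

section Geodesics

theorem IsGeodesic.toReal_eq {X : Type*} {dL : X → X → ℝ≥0∞} {γ : ℝ → X} {x y : X} (hγ : IsGeodesic dL γ x y) {s t : ℝ}
    (hs : 0 ≤ s) (hst : s ≤ t) (ht : t ≤ 1) :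
    dL (γ s) (γ t) = ENNReal.ofReal ((t - s) * (dL x y).toReal) := by
  rw [hγ.2.2.2 s ⟨hs, hst.trans ht⟩ t ⟨hs.trans hst, ht⟩, abs_sub_comm,
    abs_of_nonneg (by linarith), ENNReal.ofReal_mul (by linarith),
    ENNReal.ofReal_toReal hγ.2.2.1]

variable {X : Type*} [MetricSpace X] {dL : X → X → ℝ≥0∞}

theorem IsRaySpace.self (h : IsRaySpace dL) (x : X) : dL x x = 0 := (h.eq_zero_iff x x).2 rfl

theorem IsRaySpace.ne_top_trans (h : IsRaySpace dL) {x y z : X} (hxy : dL x y ≠ ⊤)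
    (hyz : dL y z ≠ ⊤) : dL x z ≠ ⊤ :=
  ne_top_of_le_ne_top (ENNReal.add_ne_top.2 ⟨hxy, hyz⟩) (h.triangle x y z)

theorem IsRaySpace.ne_top_symm (h : IsRaySpace dL) {x y : X} (hxy : dL x y ≠ ⊤) :
    dL y x ≠ ⊤ := by rwa [h.symm]

theorem IsRaySpace.toReal_triangle (h : IsRaySpace dL) {x y z : X} (hxy : dL x y ≠ ⊤)
    (hyz : dL y z ≠ ⊤) : (dL x z).toReal ≤ (dL x y).toReal + (dL y z).toReal := by
  rw [← ENNReal.toReal_add hxy hyz]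
  exact ENNReal.toReal_mono (ENNReal.add_ne_top.2 ⟨hxy, hyz⟩) (h.triangle x y z)

theorem IsRaySpace.toReal_pos (h : IsRaySpace dL) {x y : X} (hxy : dL x y ≠ ⊤) (hne : x ≠ y) :
    0 < (dL x y).toReal :=
  ENNReal.toReal_pos (fun h0 => hne ((h.eq_zero_iff x y).1 h0)) hxy

theorem IsRaySpace.eq_of_toReal_le_zero (h : IsRaySpace dL) {x y : X} (hxy : dL x y ≠ ⊤)
    (h0 : (dL x y).toReal ≤ 0) : x = y := by
  by_contra hne
  exact absurd (h.toReal_pos hxy hne) (not_lt.2 h0)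

/-- A curve whose increments are at most those of a constant speed parametrization is a geodesic. -/
theorem IsRaySpace.isGeodesic_of_le (h : IsRaySpace dL) {γ : ℝ → X} {x y : X} (h0 : γ 0 = x)
    (h1 : γ 1 = y) (hxy : dL x y ≠ ⊤)
    (hle : ∀ s ∈ Icc (0 : ℝ) 1, ∀ t ∈ Icc (0 : ℝ) 1, s ≤ t →
      dL (γ s) (γ t) ≤ ENNReal.ofReal (t - s) * dL x y) : IsGeodesic dL γ x y := by
  have key : ∀ s ∈ Icc (0 : ℝ) 1, ∀ t ∈ Icc (0 : ℝ) 1, s ≤ t →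
      dL (γ s) (γ t) = ENNReal.ofReal (t - s) * dL x y := by
    -- The three pieces of the curve have lengths at most their shares, and by the triangle
    -- inequality they sum to at least the whole; so none can be shorter than its share.
    intro s hs t ht hst
    refine le_antisymm (hle s hs t ht hst) ?_
    have f1 := hle 0 (by simp) s hs hs.1
    have f2 := hle s hs t ht hst
    have f3 := hle t ht 1 (by simp) ht.2
    rw [h0, sub_zero] at f1
    rw [h1] at f3
    have g1 : dL x (γ s) ≠ ⊤ := ne_top_of_le_ne_top (ENNReal.mul_ne_top (by simp) hxy) f1
    have g2 : dL (γ s) (γ t) ≠ ⊤ := ne_top_of_le_ne_top (ENNReal.mul_ne_top (by simp) hxy) f2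
    have g3 : dL (γ t) y ≠ ⊤ := ne_top_of_le_ne_top (ENNReal.mul_ne_top (by simp) hxy) f3
    have e1 := ENNReal.toReal_mono (ENNReal.mul_ne_top (by simp) hxy) f1
    have e3 := ENNReal.toReal_mono (ENNReal.mul_ne_top (by simp) hxy) f3
    rw [ENNReal.toReal_mul, ENNReal.toReal_ofReal hs.1] at e1
    rw [ENNReal.toReal_mul, ENNReal.toReal_ofReal (by linarith [ht.2])] at e3
    have t1 := h.toReal_triangle g1 g2
    have t2 := h.toReal_triangle (h.ne_top_trans g1 g2) g3
    rw [← ENNReal.toReal_le_toReal (ENNReal.mul_ne_top (by simp) hxy) g2, ENNReal.toReal_mul,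
      ENNReal.toReal_ofReal (by linarith)]
    linarith
  refine ⟨h0, h1, hxy, fun s hs t ht => ?_⟩
  rcases le_total s t with hst | hst
  · rw [key s hs t ht hst, abs_sub_comm, abs_of_nonneg (by linarith)]
  · rw [h.symm, key t ht s hs hst, abs_of_nonneg (by linarith)]

/-- Intermediate points of geodesics. -/
theorem IsRaySpace.exists_between (h : IsRaySpace dL) {x y : X} (hxy : dL x y ≠ ⊤) {r : ℝ}
    (h0 : 0 ≤ r) (hr : r ≤ (dL x y).toReal) :
    ∃ p, dL x p = ENNReal.ofReal r ∧ dL p y = ENNReal.ofReal ((dL x y).toReal - r) := by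
  obtain ⟨γ, hγ⟩ := h.exists_geodesic x y hxy
  set D := (dL x y).toReal with hD
  rcases h0.eq_or_lt with rfl | hpos
  · exact ⟨x, by simp [h.self], by simp [hD, hxy]⟩
  have hDpos : 0 < D := hpos.trans_le hr
  have hl : r / D ≤ 1 := (div_le_one hDpos).2 hr
  have hl0 : 0 ≤ r / D := by positivity
  refine ⟨γ (r / D), ?_, ?_⟩
  · have := hγ.toReal_eq le_rfl hl0 hl
    rw [hγ.1] at this
    rw [this, ← hD]; congr 1; field_simp; ring
  · have := hγ.toReal_eq hl0 hl le_rfl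
    rw [hγ.2.1] at this
    rw [this, ← hD]; congr 1; field_simp

/-- Concatenation of a given geodesic with a geodesic that prolongs it. -/
theorem IsRaySpace.exists_isGeodesic_concat (h : IsRaySpace dL) {p x a : X} {γ : ℝ → X}
    (hγ : IsGeodesic dL γ p x) (hpx : p ≠ x) (hxa : x ≠ a) (hxa' : dL x a ≠ ⊤)
    (hadd : (dL p x).toReal + (dL x a).toReal ≤ (dL p a).toReal) :
    ∃ γ' : ℝ → X, IsGeodesic dL γ' p a ∧
      EqOn γ' (fun t => γ (t / ((dL p x).toReal / (dL p a).toReal)))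
        (Icc 0 ((dL p x).toReal / (dL p a).toReal)) := by
  obtain ⟨σ, hσ⟩ := h.exists_geodesic x a hxa'
  have hpx' := hγ.2.2.1
  have hpa := h.ne_top_trans hpx' hxa'
  have h1 := h.toReal_pos hpx' hpx
  have h2 := h.toReal_pos hxa' hxa
  have h3 := h.toReal_triangle hpx' hxa'
  set P := (dL p x).toReal with hP
  set Q := (dL x a).toReal with hQ
  set D := (dL p a).toReal with hD
  have hDeq : D = P + Q := le_antisymm h3 hadd
  have hDpos : 0 < D := by linarith
  set s := P / D with hs
  have hs0 : 0 < s := by positivity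
  have hs1 : s < 1 := (div_lt_one hDpos).2 (by linarith)
  have h1s : 1 - s = Q / D := by rw [hs]; field_simp; linarith
  have hsP : P / s = D := by rw [hs]; field_simp
  have hsQ : Q / (1 - s) = D := by rw [h1s]; field_simp
  set γ' : ℝ → X := fun t => if t ≤ s then γ (t / s) else σ ((t - s) / (1 - s)) with hγ'
  have e1 : ∀ t, t ≤ s → γ' t = γ (t / s) := fun t ht => by simp [hγ', ht]
  have e2 : ∀ t, s ≤ t → γ' t = σ ((t - s) / (1 - s)) := by
    intro t ht
    rcases ht.eq_or_lt with rfl | ht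
    · simp [hγ', hσ.1, hγ.2.1, hs0.ne']
    · simp [hγ', not_le.2 ht]
  have hDe : dL p a = ENNReal.ofReal D := by rw [hD, ENNReal.ofReal_toReal hpa]
  have d1 : ∀ u v, 0 ≤ u → u ≤ v → v ≤ s → dL (γ' u) (γ' v) = ENNReal.ofReal ((v - u) * D) := by
    intro u v hu huv hv
    rw [e1 u (huv.trans hv), e1 v hv, hγ.toReal_eq (by positivity)
      (by gcongr) ((div_le_one hs0).2 hv), ← hP, ← hsP]
    congr 1; ring
  have d2 : ∀ u v, s ≤ u → u ≤ v → v ≤ 1 → dL (γ' u) (γ' v) = ENNReal.ofReal ((v - u) * D) := by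
    intro u v hu huv hv
    have : 0 < 1 - s := by linarith
    rw [e2 u hu, e2 v (hu.trans huv), hσ.toReal_eq (div_nonneg (by linarith) this.le)
      (by gcongr) ((div_le_one this).2 (by linarith)), ← hQ, ← hsQ]
    congr 1; ring
  refine ⟨γ', h.isGeodesic_of_le ?_ ?_ hpa ?_, fun t ht => e1 t ht.2⟩
  · rw [e1 0 hs0.le, zero_div, hγ.1]
  · rw [e2 1 hs1.le, div_self (by linarith), hσ.2.1]
  · intro u hu v hv huv
    rw [hDe, ← ENNReal.ofReal_mul (by linarith)]
    rcases le_total v s with hvs | hvs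
    · exact (d1 u v hu.1 huv hvs).le
    rcases le_total s u with hus | hus
    · exact (d2 u v hus huv hv.2).le
    · refine (h.triangle _ (γ' s) _).trans ?_
      rw [d1 u s hu.1 hus le_rfl, d2 s v le_rfl hvs hv.2, ← ENNReal.ofReal_add
        (mul_nonneg (by linarith) hDpos.le) (mul_nonneg (by linarith) hDpos.le)]
      apply le_of_eq; congr 1; ring

/-- Two prolongations of a nontrivial geodesic are comparable. -/
theorem IsRaySpace.add_le_of_prolongations (h : IsRaySpace dL) {p x a b : X} (hpx : p ≠ x)
    (hpx' : dL p x ≠ ⊤) (hxa : dL x a ≠ ⊤) (hxb : dL x b ≠ ⊤)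
    (ha : (dL p x).toReal + (dL x a).toReal ≤ (dL p a).toReal)
    (hb : (dL p x).toReal + (dL x b).toReal ≤ (dL p b).toReal)
    (hab : (dL x a).toReal ≤ (dL x b).toReal) :
    (dL x a).toReal + (dL a b).toReal ≤ (dL x b).toReal := by
  by_cases hax : x = a
  · subst hax; simp [h.self]
  obtain ⟨b', h1, h2⟩ := h.exists_between hxb ENNReal.toReal_nonneg hab
  rw [ENNReal.ofReal_toReal hxa] at h1
  have hb't : dL x b' ≠ ⊤ := by rw [h1]; exact hxa
  have h2t : dL b' b ≠ ⊤ := by rw [h2]; simp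
  have h2' : (dL b' b).toReal = (dL x b).toReal - (dL x a).toReal := by
    rw [h2, ENNReal.toReal_ofReal (by linarith)]
  have hxb' : x ≠ b' := by
    rintro rfl
    exact hax ((h.eq_zero_iff x a).1 (by rw [← h1, h.self]))
  have t1 := h.toReal_triangle (h.ne_top_trans hpx' hb't) h2t
  have t2 := h.toReal_triangle hpx' hb't
  have t3 := h.toReal_triangle hpx' hxa
  have h1' : (dL x b').toReal = (dL x a).toReal := by rw [h1]
  have eq : (dL p b').toReal = (dL p a).toReal := by linarith
  obtain ⟨γ, hγ⟩ := h.exists_geodesic p x hpx'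
  obtain ⟨γ₁, hγ₁, hs₁⟩ := h.exists_isGeodesic_concat hγ hpx hax hxa ha
  obtain ⟨γ₂, hγ₂, hs₂⟩ := h.exists_isGeodesic_concat hγ hpx hxb' hb't (by linarith)
  -- Both concatenations start with `γ` and have equal total length, so they pass through `x` at the
  -- same parameter and agree up to it. Nonbranching identifies their end points.
  rw [eq] at hs₂
  have h0 := h.toReal_pos hpx' hpx
  have h0' := h.toReal_pos hxa hax
  have hab' : a = b' := by
    have := h.nonbranching γ₁ γ₂ p a b' hγ₁ hγ₂ ((dL p x).toReal / (dL p a).toReal)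
      ⟨div_pos h0 (by linarith), (div_lt_one (by linarith)).2 (by linarith)⟩
      (hs₁.trans hs₂.symm) (show (1 : ℝ) ∈ Icc 0 1 by simp)
    rwa [hγ₁.2.1, hγ₂.2.1] at this
  subst hab'
  linarith

end Geodesics

/-! ### Pairs compatible with a cyclically monotone set. -/

section Compatible

variable {X : Type*} {dL : X → X → ℝ≥0∞} {Γ : Set (X × X)}

/-- Adding the pair `(x, y)` to `Γ` does not destroy cyclical monotonicity. -/
def IsCompatiblePair (dL : X → X → ℝ≥0∞) (Γ : Set (X × X)) (x y : X) : Prop :=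
  ∀ w z P Q, ChainCost dL Γ w z P Q → P + dL x y ≤ Q + dL x z + dL w y

theorem ne_top_of_mem_cycleSet (hf : ∀ p ∈ Γ, dL p.1 p.2 ≠ ⊤) {w z : X}
    (hw : (w, z) ∈ cycleSet dL Γ) : dL w z ≠ ⊤ := by
  obtain ⟨P, Q, hc, hs⟩ := mem_cycleSet_iff.1 hw
  have := hc.ne_top hf
  rw [← hs] at this
  exact (ENNReal.add_ne_top.1 this).2

/-- A pair of `Γ'` behaves like a pair of `Γ`: the linking cost `Q` of its chain is finite and
cancels. -/
theorem IsCompatiblePair.le_of_mem_cycleSet (hf : ∀ p ∈ Γ, dL p.1 p.2 ≠ ⊤) {x y w z : X}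
    (hxy : IsCompatiblePair dL Γ x y) (hw : (w, z) ∈ cycleSet dL Γ) :
    dL w z + dL x y ≤ dL x z + dL w y := by
  obtain ⟨P, Q, hc, hs⟩ := mem_cycleSet_iff.1 hw
  have h1 := hxy _ _ _ _ hc
  have := hc.ne_top hf
  rw [← hs] at this
  have hQ := (ENNReal.add_ne_top.1 this).1
  rw [← hs, add_assoc, add_assoc] at h1
  exact (ENNReal.add_le_add_iff_left hQ).1 h1

/-- The given chain is glued to the zero-cost cycle through `(x, y)`; monotonicity of the result is
the claim once the finite `Q'` is cancelled. -/
theorem isCompatiblePair_of_mem_cycleSet (hm : IsCyclicallyMonotone dL Γ)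
    (hf : ∀ p ∈ Γ, dL p.1 p.2 ≠ ⊤) {x y : X} (hxy : (x, y) ∈ cycleSet dL Γ) :
    IsCompatiblePair dL Γ x y := by
  intro w z P Q hc
  obtain ⟨P', Q', hc', hs⟩ := mem_cycleSet_iff.1 hxy
  have h1 := isCyclicallyMonotone_iff.1 hm _ _ _ _ (hc.append hc')
  have := hc'.ne_top hf
  rw [← hs] at this h1
  have hQ := (ENNReal.add_ne_top.1 this).1
  rw [← ENNReal.add_le_add_iff_left hQ]
  calc Q' + (P + dL x y) = P + (Q' + dL x y) := by ring
    _ ≤ _ := h1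
    _ = _ := by ring

/-- One inequality for the glued chain is cyclical monotonicity, the other is `hle`. -/
theorem mem_cycleSet_of_exchange (hm : IsCyclicallyMonotone dL Γ) {w z w' z' : X}
    (hw : (w, z) ∈ cycleSet dL Γ) (hw' : (w', z') ∈ cycleSet dL Γ)
    (hle : dL w z' + dL w' z ≤ dL w z + dL w' z') : (w, z') ∈ cycleSet dL Γ := by
  obtain ⟨P, Q, hc, hs⟩ := mem_cycleSet_iff.1 hw
  obtain ⟨P', Q', hc', hs'⟩ := mem_cycleSet_iff.1 hw'
  refine mem_cycleSet_iff.2 ⟨_, _, hc.append hc',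
    le_antisymm ?_ (isCyclicallyMonotone_iff.1 hm _ _ _ _ (hc.append hc'))⟩
  rw [← hs, ← hs']
  calc Q + Q' + dL w' z + dL w z' = Q + Q' + (dL w z' + dL w' z) := by ring
    _ ≤ Q + Q' + (dL w z + dL w' z') := by gcongr
    _ = _ := by ring

end Compatible

/-! ### The order along transport rays, signed positions and translates. -/

section Order

variable {X : Type*} [MetricSpace X] {dL : X → X → ℝ≥0∞} {Γ : Set (X × X)}

theorem IsCompatiblePair.of_between (h : IsRaySpace dL) {w x y z : X}
    (hwz : IsCompatiblePair dL Γ w z) (hfin : dL w z ≠ ⊤)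
    (hle : dL w x + dL x y + dL y z = dL w z) : IsCompatiblePair dL Γ x y := by
  intro a b P Q hc
  have h1 := hwz _ _ _ _ hc
  rw [← hle] at h1 hfin
  have f1 := (ENNReal.add_ne_top.1 hfin)
  have f2 := (ENNReal.add_ne_top.1 f1.1)
  have t1 := h.triangle w x b
  have t2 := h.triangle a y z
  rw [← ENNReal.add_le_add_iff_left f2.1, ← ENNReal.add_le_add_iff_right f1.2]
  calc dL w x + (P + dL x y) + dL y z = P + (dL w x + dL x y + dL y z) := by ring
    _ ≤ Q + dL w b + dL a z := h1
    _ ≤ Q + (dL w x + dL x b) + (dL a y + dL y z) := by gcongr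
    _ = _ := by ring

theorem mem_orientedRays_iff (h : IsRaySpace dL) (hf : ∀ p ∈ Γ, dL p.1 p.2 ≠ ⊤) {x y : X} :
    (x, y) ∈ orientedRays dL Γ ↔ ∃ w z, (w, z) ∈ cycleSet dL Γ ∧ dL w x ≠ ⊤ ∧ dL x y ≠ ⊤ ∧
      dL y z ≠ ⊤ ∧ (dL w x).toReal + (dL x y).toReal + (dL y z).toReal ≤ (dL w z).toReal := by
  constructor
  · rintro ⟨⟨w, z⟩, hw, hle⟩
    dsimp only at hle
    have hfin := ne_top_of_mem_cycleSet hf hw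
    rw [← hle] at hfin
    have f1 := (ENNReal.add_ne_top.1 hfin)
    have f2 := (ENNReal.add_ne_top.1 f1.1)
    refine ⟨w, z, hw, f2.1, f2.2, f1.2, ?_⟩
    rw [← hle, ENNReal.toReal_add f1.1 f1.2, ENNReal.toReal_add f2.1 f2.2]
  · rintro ⟨w, z, hw, h1, h2, h3, hle⟩
    refine ⟨(w, z), hw, le_antisymm ?_ ?_⟩
    · have hfin := ne_top_of_mem_cycleSet hf hw
      rw [← ENNReal.toReal_le_toReal (ENNReal.add_ne_top.2 ⟨ENNReal.add_ne_top.2 ⟨h1, h2⟩, h3⟩) hfin,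
        ENNReal.toReal_add (ENNReal.add_ne_top.2 ⟨h1, h2⟩) h3, ENNReal.toReal_add h1 h2]
      exact hle
    · exact (h.triangle _ y _).trans (by gcongr; exact h.triangle _ _ _)

theorem ne_top_of_mem_orientedRays (h : IsRaySpace dL) (hf : ∀ p ∈ Γ, dL p.1 p.2 ≠ ⊤) {x y : X}
    (hxy : (x, y) ∈ orientedRays dL Γ) : dL x y ≠ ⊤ := by
  obtain ⟨_, _, _, _, h2, _⟩ := (mem_orientedRays_iff h hf).1 hxy
  exact h2

theorem isCompatiblePair_of_mem_orientedRays (h : IsRaySpace dL) (hm : IsCyclicallyMonotone dL Γ)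
    (hf : ∀ p ∈ Γ, dL p.1 p.2 ≠ ⊤) {x y : X} (hxy : (x, y) ∈ orientedRays dL Γ) :
    IsCompatiblePair dL Γ x y := by
  obtain ⟨⟨w, z⟩, hw, hle⟩ := hxy
  exact (isCompatiblePair_of_mem_cycleSet hm hf hw).of_between h (ne_top_of_mem_cycleSet hf hw) hle

theorem mem_orientedRays_of_between (h : IsRaySpace dL) (hf : ∀ p ∈ Γ, dL p.1 p.2 ≠ ⊤)
    {x y a b : X} (hxy : (x, y) ∈ orientedRays dL Γ) (h1 : dL x a ≠ ⊤) (h2 : dL a b ≠ ⊤)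
    (h3 : dL b y ≠ ⊤) (hle : (dL x a).toReal + (dL a b).toReal + (dL b y).toReal ≤
      (dL x y).toReal) : (a, b) ∈ orientedRays dL Γ := by
  obtain ⟨w, z, hw, g1, g2, g3, hle'⟩ := (mem_orientedRays_iff h hf).1 hxy
  refine (mem_orientedRays_iff h hf).2 ⟨w, z, hw, h.ne_top_trans g1 h1, h2,
    h.ne_top_trans h3 g3, ?_⟩
  have := h.toReal_triangle g1 h1
  have := h.toReal_triangle h3 g3
  linarith

/-- `G` is transitive, and distances add up along it. -/
theorem orientedRays_trans (h : IsRaySpace dL) (hm : IsCyclicallyMonotone dL Γ)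
    (hf : ∀ p ∈ Γ, dL p.1 p.2 ≠ ⊤) {x y z : X} (hxy : (x, y) ∈ orientedRays dL Γ)
    (hyz : (y, z) ∈ orientedRays dL Γ) : (x, z) ∈ orientedRays dL Γ ∧
      (dL x z).toReal = (dL x y).toReal + (dL y z).toReal := by
  obtain ⟨w, v, hw, g1, g2, g3, hle⟩ := (mem_orientedRays_iff h hf).1 hxy
  obtain ⟨w', v', hw', g1', g2', g3', hle'⟩ := (mem_orientedRays_iff h hf).1 hyz
  have hfin := ne_top_of_mem_cycleSet hf hw
  have hfin' := ne_top_of_mem_cycleSet hf hw'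
  -- Monotonicity bounds `d(w,v) + d(w',v')` by the exchanged sum, while triangle inequalities
  -- through `y` bound the exchanged sum by the same number. Hence all are equalities and the
  -- exchange is free.
  have hex := (isCompatiblePair_of_mem_cycleSet hm hf hw').le_of_mem_cycleSet hf hw
  have f1 : dL w' v ≠ ⊤ := h.ne_top_trans g1' g3
  have f2 : dL w v' ≠ ⊤ := h.ne_top_trans g1 (h.ne_top_trans g2 (h.ne_top_trans g2' g3'))
  have hexr := ENNReal.toReal_mono (ENNReal.add_ne_top.2 ⟨f1, f2⟩) hex
  rw [ENNReal.toReal_add hfin hfin', ENNReal.toReal_add f1 f2] at hexr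
  have t1 := h.toReal_triangle g1' g3
  have t2 := h.toReal_triangle (h.ne_top_trans g1 g2) (h.ne_top_trans g2' g3')
  have t3 := h.toReal_triangle g1 g2
  have t4 := h.toReal_triangle g2' g3'
  have t5 := h.toReal_triangle g2 g2'
  have f3 := h.ne_top_trans g2 g2'
  have t6 := h.toReal_triangle g1 f3
  have t7 := h.toReal_triangle (h.ne_top_trans g1 f3) g3'
  have hcyc : (w, v') ∈ cycleSet dL Γ := by
    refine mem_cycleSet_of_exchange hm hw hw' ?_
    rw [← ENNReal.toReal_le_toReal (ENNReal.add_ne_top.2 ⟨f2, f1⟩)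
      (ENNReal.add_ne_top.2 ⟨hfin, hfin'⟩), ENNReal.toReal_add hfin hfin',
      ENNReal.toReal_add f2 f1]
    linarith
  refine ⟨(mem_orientedRays_iff h hf).2 ⟨w, v', hcyc, g1, f3, g3', by linarith⟩, by linarith⟩

theorem orientedRays_antisymm (h : IsRaySpace dL) (hm : IsCyclicallyMonotone dL Γ)
    (hf : ∀ p ∈ Γ, dL p.1 p.2 ≠ ⊤) {x y : X} (hxy : (x, y) ∈ orientedRays dL Γ)
    (hyx : (y, x) ∈ orientedRays dL Γ) : x = y := by
  have := (orientedRays_trans h hm hf hxy hyx).2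
  rw [h.self] at this
  refine h.eq_of_toReal_le_zero (ne_top_of_mem_orientedRays h hf hxy) ?_
  have h1 : 0 ≤ (dL y x).toReal := ENNReal.toReal_nonneg
  simp only [ENNReal.toReal_zero] at this
  linarith

theorem orientedRays_refl_left (h : IsRaySpace dL) (hf : ∀ p ∈ Γ, dL p.1 p.2 ≠ ⊤) {x y : X}
    (hxy : (x, y) ∈ orientedRays dL Γ) : (x, x) ∈ orientedRays dL Γ :=
  mem_orientedRays_of_between h hf hxy (by simp [h.self]) (by simp [h.self])
    (ne_top_of_mem_orientedRays h hf hxy) (by simp [h.self])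

/-- Rays may fork at an initial point; the point `p` strictly before `x` provides the common segment
required by nonbranching. -/
theorem orientedRays_comparable_right (h : IsRaySpace dL) (hm : IsCyclicallyMonotone dL Γ)
    (hf : ∀ p ∈ Γ, dL p.1 p.2 ≠ ⊤) {p x a b : X} (hpx : p ≠ x)
    (hp : (p, x) ∈ orientedRays dL Γ) (ha : (x, a) ∈ orientedRays dL Γ)
    (hb : (x, b) ∈ orientedRays dL Γ) (hab : (dL x a).toReal ≤ (dL x b).toReal) :
    (a, b) ∈ orientedRays dL Γ ∧ (dL a b).toReal = (dL x b).toReal - (dL x a).toReal := by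
  have fa := ne_top_of_mem_orientedRays h hf ha
  have fb := ne_top_of_mem_orientedRays h hf hb
  have fab := h.ne_top_trans (h.ne_top_symm fa) fb
  have := h.add_le_of_prolongations hpx (ne_top_of_mem_orientedRays h hf hp) fa fb
    (orientedRays_trans h hm hf hp ha).2.ge (orientedRays_trans h hm hf hp hb).2.ge hab
  have t := h.toReal_triangle fa fab
  refine ⟨mem_orientedRays_of_between h hf hb fa fab (by simp [h.self]) ?_, by linarith⟩
  simpa [h.self] using this

theorem orientedRays_comparable_left (h : IsRaySpace dL) (hm : IsCyclicallyMonotone dL Γ)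
    (hf : ∀ p ∈ Γ, dL p.1 p.2 ≠ ⊤) {q x a b : X} (hxq : x ≠ q)
    (hq : (x, q) ∈ orientedRays dL Γ) (ha : (a, x) ∈ orientedRays dL Γ)
    (hb : (b, x) ∈ orientedRays dL Γ) (hab : (dL a x).toReal ≤ (dL b x).toReal) :
    (b, a) ∈ orientedRays dL Γ ∧ (dL b a).toReal = (dL b x).toReal - (dL a x).toReal := by
  have fa := ne_top_of_mem_orientedRays h hf ha
  have fb := ne_top_of_mem_orientedRays h hf hb
  have fba := h.ne_top_trans fb (h.ne_top_symm fa)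
  have e1 := (orientedRays_trans h hm hf ha hq).2
  have e2 := (orientedRays_trans h hm hf hb hq).2
  have fq := ne_top_of_mem_orientedRays h hf hq
  have t := h.toReal_triangle fba fa
  have := h.add_le_of_prolongations (p := q) (x := x) (a := a) (b := b) hxq.symm
    (h.ne_top_symm fq) (h.ne_top_symm fa) (h.ne_top_symm fb)
    (by rw [h.symm q x, h.symm x a, h.symm q a]; linarith)
    (by rw [h.symm q x, h.symm x b, h.symm q b]; linarith) (by rwa [h.symm x a, h.symm x b])
  rw [h.symm x a, h.symm x b, h.symm a b] at this
  refine ⟨mem_orientedRays_of_between h hf hb (by simp [h.self]) fba fa ?_, by linarith⟩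
  simp only [h.self, ENNReal.toReal_zero, zero_add]
  linarith

open Classical in
/-- The signed distance of `x` from the base point `y` along the rays. -/
noncomputable def rayPosition (dL : X → X → ℝ≥0∞) (Γ : Set (X × X)) (y x : X) : ℝ :=
  if (y, x) ∈ orientedRays dL Γ then (dL x y).toReal else -(dL x y).toReal

/-- Points on opposite sides of `y` are compared by transitivity, points on the same side by
nonbranching, which needs a point of the ray beyond `y`. Both exist because `y` is not an end point.
-/
theorem rayPosition_spec (h : IsRaySpace dL) (hm : IsCyclicallyMonotone dL Γ)
    (hf : ∀ p ∈ Γ, dL p.1 p.2 ≠ ⊤) {y x x' : X} (hy : y ∈ transportSet dL Γ)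
    (hx : (y, x) ∈ rays dL Γ) (hx' : (y, x') ∈ rays dL Γ)
    (hle : rayPosition dL Γ y x ≤ rayPosition dL Γ y x') :
    (x, x') ∈ orientedRays dL Γ ∧
      (dL x x').toReal = rayPosition dL Γ y x' - rayPosition dL Γ y x := by
  obtain ⟨⟨p, hpy, hp⟩, q, hqy, hq⟩ := hy
  have hyy := orientedRays_refl_left h hf hq
  unfold rayPosition at *
  by_cases h1 : (y, x) ∈ orientedRays dL Γ <;> by_cases h2 : (y, x') ∈ orientedRays dL Γ
  · simp only [h1, h2, if_true] at hle ⊢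
    rw [h.symm x y, h.symm x' y] at *
    exact orientedRays_comparable_right h hm hf hpy hp h1 h2 hle
  · exfalso
    have h2' : (x', y) ∈ orientedRays dL Γ := hx'.resolve_left h2
    simp only [h1, h2, if_true, if_false] at hle
    have : x' = y := h.eq_of_toReal_le_zero (ne_top_of_mem_orientedRays h hf h2')
      (by linarith [ENNReal.toReal_nonneg (a := dL x y)])
    exact h2 (this ▸ hyy)
  · have h1' : (x, y) ∈ orientedRays dL Γ := hx.resolve_left h1
    simp only [h1, h2, if_true, if_false]
    have := orientedRays_trans h hm hf h1' h2
    rw [h.symm x' y]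
    exact ⟨this.1, by linarith [this.2]⟩
  · have h1' : (x, y) ∈ orientedRays dL Γ := hx.resolve_left h1
    have h2' : (x', y) ∈ orientedRays dL Γ := hx'.resolve_left h2
    simp only [h1, h2, if_false] at hle ⊢
    have := orientedRays_comparable_left h hm hf hqy.symm hq h2' h1' (by linarith)
    exact ⟨this.1, by linarith [this.2]⟩

theorem rayPosition_nonneg_iff (h : IsRaySpace dL) (hf : ∀ p ∈ Γ, dL p.1 p.2 ≠ ⊤) {y x : X}
    (hx : (y, x) ∈ rays dL Γ) : 0 ≤ rayPosition dL Γ y x ↔ (y, x) ∈ orientedRays dL Γ := by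
  unfold rayPosition
  by_cases h1 : (y, x) ∈ orientedRays dL Γ
  · simp [h1]
  · have h1' : (x, y) ∈ orientedRays dL Γ := hx.resolve_left h1
    simp only [h1, if_false, iff_false, not_le]
    have := h.toReal_pos (ne_top_of_mem_orientedRays h hf h1')
      (fun e => h1 (e ▸ orientedRays_refl_left h hf h1'))
    linarith

theorem rays_of_middle (h : IsRaySpace dL) (hm : IsCyclicallyMonotone dL Γ)
    (hf : ∀ p ∈ Γ, dL p.1 p.2 ≠ ⊤) {p x y : X} (hp : p ∈ transportSet dL Γ)
    (hx : (p, x) ∈ rays dL Γ) (hy : (p, y) ∈ rays dL Γ) : (x, y) ∈ rays dL Γ := by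
  rcases le_total (rayPosition dL Γ p x) (rayPosition dL Γ p y) with hle | hle
  · exact Or.inl (rayPosition_spec h hm hf hp hx hy hle).1
  · exact Or.inr (rayPosition_spec h hm hf hp hy hx hle).1

theorem mem_rayGraph_iff (h : IsRaySpace dL) (hm : IsCyclicallyMonotone dL Γ)
    (hf : ∀ p ∈ Γ, dL p.1 p.2 ≠ ⊤) {f : X → X} {y x : X}
    {t : ℝ} : (y, t, x) ∈ rayGraph dL Γ f ↔
      y ∈ f '' transportSet dL Γ ∧ (y, x) ∈ rays dL Γ ∧ rayPosition dL Γ y x = t := by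
  simp only [rayGraph, mem_ofPred_eq]
  refine and_congr_right fun hy => ?_
  constructor
  · rintro (⟨ht, hG, hd⟩ | ⟨ht, hG, hd⟩)
    · refine ⟨Or.inl hG, ?_⟩
      rw [rayPosition, if_pos hG, hd, ENNReal.toReal_ofReal ht]
    · refine ⟨Or.inr hG, ?_⟩
      have : (y, x) ∉ orientedRays dL Γ := by
        rw [← rayPosition_nonneg_iff h hf (Or.inr hG), rayPosition]
        split_ifs with h1
        · have hxy := orientedRays_antisymm h hm hf h1 hG
          subst hxy
          rw [h.self, eq_comm, ENNReal.ofReal_eq_zero] at hd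
          linarith
        · rw [hd, ENNReal.toReal_ofReal (by linarith)]; linarith
      rw [rayPosition, if_neg this, hd, ENNReal.toReal_ofReal (by linarith)]; ring
  · rintro ⟨hR, rfl⟩
    by_cases h1 : (y, x) ∈ orientedRays dL Γ
    · refine Or.inl ⟨(rayPosition_nonneg_iff h hf hR).2 h1, h1, ?_⟩
      rw [rayPosition, if_pos h1, h.symm, ENNReal.ofReal_toReal (ne_top_of_mem_orientedRays h hf h1)]
    · have h1' : (x, y) ∈ orientedRays dL Γ := hR.resolve_left h1
      refine Or.inr ⟨not_le.1 fun h0 => h1 ((rayPosition_nonneg_iff h hf hR).1 h0), h1', ?_⟩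
      rw [rayPosition, if_neg h1, neg_neg, ENNReal.ofReal_toReal (ne_top_of_mem_orientedRays h hf h1')]

theorem translate_subset (h : IsRaySpace dL) (hm : IsCyclicallyMonotone dL Γ)
    (hf : ∀ p ∈ Γ, dL p.1 p.2 ≠ ⊤) {f : X → X} (hcs : IsCrossSection dL Γ f) {A : Set X} {t : ℝ}
    (ht : 0 < t) : translate dL Γ f A t ⊆
      {z | ∃ x ∈ A, (x, z) ∈ orientedRays dL Γ ∧ (dL x z).toReal = t} := by
  rintro z ⟨y, τ, x, hx, h1, h2⟩
  obtain ⟨⟨v, hv, rfl⟩, hR, h3⟩ := (mem_rayGraph_iff h hm hf).1 h1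
  obtain ⟨-, hR', h3'⟩ := (mem_rayGraph_iff h hm hf).1 h2
  have := rayPosition_spec h hm hf (hcs.mapsTo hv) hR hR' (by linarith)
  exact ⟨x, hx, this.1, by linarith [this.2]⟩

/-- The points `x` and `z` may be end points, about which `f` says nothing. The midpoint `p` lies in
`𝒯`, and `f p` is a base point for both. -/
theorem subset_translate (h : IsRaySpace dL) (hm : IsCyclicallyMonotone dL Γ)
    (hf : ∀ p ∈ Γ, dL p.1 p.2 ≠ ⊤) {f : X → X} (hcs : IsCrossSection dL Γ f) {A : Set X} {t : ℝ}
    (ht : 0 < t) : {z | ∃ x ∈ A, (x, z) ∈ orientedRays dL Γ ∧ (dL x z).toReal = t} ⊆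
      translate dL Γ f A t := by
  rintro z ⟨x, hx, hG, hd⟩
  have hfin := ne_top_of_mem_orientedRays h hf hG
  obtain ⟨p, h1, h2⟩ := h.exists_between hfin (r := t / 2) (by linarith) (by linarith)
  have f1 : dL x p ≠ ⊤ := by simp [h1]
  have f2 : dL p z ≠ ⊤ := by simp [h2]
  have r1 : (dL x p).toReal = t / 2 := by rw [h1, ENNReal.toReal_ofReal (by linarith)]
  have r2 : (dL p z).toReal = t / 2 := by
    rw [h2, hd, ENNReal.toReal_ofReal (by linarith)]; ring
  have hxp : (x, p) ∈ orientedRays dL Γ := mem_orientedRays_of_between h hf hG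
    (by simp [h.self]) f1 f2 (by simp only [h.self, ENNReal.toReal_zero]; linarith)
  have hpz : (p, z) ∈ orientedRays dL Γ := mem_orientedRays_of_between h hf hG
    f1 f2 (by simp [h.self]) (by simp only [h.self, ENNReal.toReal_zero]; linarith)
  have hpT : p ∈ transportSet dL Γ := by
    refine ⟨⟨x, ?_, hxp⟩, z, ?_, hpz⟩
    · rintro rfl; rw [h.self] at r1; simp at r1; linarith
    · rintro rfl; rw [h.self] at r2; simp at r2; linarith
  have hyT := hcs.mapsTo hpT
  have hpy := hcs.rel p hpT
  have hyx : (f p, x) ∈ rays dL Γ := rays_of_middle h hm hf hpT hpy (Or.inr hxp)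
  have hyz : (f p, z) ∈ rays dL Γ := rays_of_middle h hm hf hpT hpy (Or.inl hpz)
  refine ⟨f p, rayPosition dL Γ (f p) x, x, hx,
    (mem_rayGraph_iff h hm hf).2 ⟨⟨p, hpT, rfl⟩, hyx, rfl⟩,
    (mem_rayGraph_iff h hm hf).2 ⟨⟨p, hpT, rfl⟩, hyz, ?_⟩⟩
  rcases le_total (rayPosition dL Γ (f p) x) (rayPosition dL Γ (f p) z) with hle | hle
  · have := (rayPosition_spec h hm hf hyT hyx hyz hle).2
    linarith
  · exfalso
    have := (rayPosition_spec h hm hf hyT hyz hyx hle).1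
    have := orientedRays_antisymm h hm hf hG this
    subst this
    rw [h.self] at hd
    simp at hd
    linarith

end Order

/-! ### Capacitability and universal measurability of analytic sets. -/

section Analytic

/-- Analytic sets are capacitable: they are approximated from inside by compact sets. -/
theorem exists_isCompact_le_measure_of_analyticSet {α : Type*} [TopologicalSpace α]
    [MeasurableSpace α] {μ : Measure α} [μ.OuterRegular] {s : Set α} (hs : AnalyticSet s)
    {a : ℝ≥0∞} (ha : a < μ s) : ∃ K ⊆ s, IsCompact K ∧ a ≤ μ K := by
  rw [AnalyticSet] at hs
  rcases hs with rfl | ⟨f, hf, rfl⟩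
  · simp at ha
  -- Bounding one more coordinate keeps the measure of the image above `a`: continuity from below
  -- along increasing unions needs no measurability.
  have step : ∀ (k : ℕ) (D : {D : Set (ℕ → ℕ) // a < μ (f '' D)}),
      ∃ m : ℕ, a < μ (f '' (D.1 ∩ {σ | σ k ≤ m})) := by
    rintro k ⟨D, hD⟩
    have hU : f '' D = ⋃ m : ℕ, f '' (D ∩ {σ | σ k ≤ m}) := by
      rw [← image_iUnion, ← inter_iUnion]
      congr 1
      refine (inter_eq_left.2 fun σ _ => mem_iUnion.2 ⟨σ k, by simp⟩).symm
    have hmono : Monotone fun m : ℕ => f '' (D ∩ {σ | σ k ≤ m}) := fun m m' h =>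
      image_mono (inter_subset_inter_right _ fun σ (hσ : σ k ≤ m) => hσ.trans h)
    rw [hU, hmono.measure_iUnion, lt_iSup_iff] at hD
    exact hD
  choose m hm using step
  let D : ℕ → {D : Set (ℕ → ℕ) // a < μ (f '' D)} := fun k =>
    Nat.rec ⟨univ, by simpa using ha⟩ (fun k D => ⟨D.1 ∩ {σ | σ k ≤ m k D}, hm k D⟩) k
  let n : ℕ → ℕ := fun k => m k (D k)
  have hD : ∀ k σ, (∀ i < k, σ i ≤ n i) ↔ σ ∈ (D k).1 := by
    intro k σ
    induction k with
    | zero => simp [D]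
    | succ k ih =>
      have : σ ∈ (D (k + 1)).1 ↔ σ ∈ (D k).1 ∧ σ k ≤ n k := Iff.rfl
      rw [this, ← ih, Nat.forall_lt_succ_right]
  set K : Set (ℕ → ℕ) := Set.pi univ fun i => Iic (n i) with hKdef
  have hK : IsCompact K := isCompact_univ_pi fun i => (finite_Iic (n i)).isCompact
  refine ⟨f '' K, image_subset_range _ _, hK.image hf, le_of_not_gt fun hlt => ?_⟩
  obtain ⟨U, hKU, hUo, hU⟩ := (f '' K).exists_isOpen_lt_of_lt a hlt
  have hV : IsOpen (f ⁻¹' U) := hUo.preimage hf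
  suffices ∃ k, (D k).1 ⊆ f ⁻¹' U by
    obtain ⟨k, hk⟩ := this
    exact absurd ((D k).2.trans_le (measure_mono (image_subset_iff.2 hk))) (not_lt.2 hU.le)
  by_contra! hne
  have : ∀ k, ∃ σ ∈ (D k).1, σ ∉ f ⁻¹' U := fun k => not_subset.1 (hne k)
  choose σ hσ hσU using this
  -- Truncation brings `σ k` into the compact set `K` without changing its coordinates below `k`, so
  -- `σ` has a subsequence converging to a point of `K`.
  have hτ : ∀ k, (fun i => min (σ k i) (n i)) ∈ K := fun k i _ => mem_Iic.2 (min_le_right _ _)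
  obtain ⟨τ, hτK, φ, hφ, hlim⟩ := hK.tendsto_subseq hτ
  have hlim' : Tendsto (fun k => σ (φ k)) atTop (𝓝 τ) := by
    rw [tendsto_pi_nhds] at hlim ⊢
    intro i
    refine (hlim i).congr' ?_
    filter_upwards [eventually_gt_atTop i] with k hk
    have := (hD _ _).2 (hσ (φ k)) i (hk.trans_le (hφ.id_le k))
    simpa using this
  have := (hlim'.eventually (hV.mem_nhds (hKU (mem_image_of_mem f hτK)))).exists
  obtain ⟨k, hk⟩ := this
  exact hσU _ hk

/-- Analytic sets are universally measurable. -/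
theorem nullMeasurableSet_of_analyticSet {α : Type*} [TopologicalSpace α] [T2Space α]
    [MeasurableSpace α] [BorelSpace α] {μ : Measure α} [IsFiniteMeasure μ] [μ.OuterRegular]
    {s : Set α} (hs : AnalyticSet s) : NullMeasurableSet s μ := by
  have : ∀ k : ℕ, ∃ K ⊆ s, MeasurableSet K ∧ μ s ≤ μ K + ((k : ℝ≥0∞) + 1)⁻¹ := by
    intro k
    by_cases h0 : μ s = 0
    · exact ⟨∅, empty_subset _, MeasurableSet.empty, by simp [h0]⟩
    have hlt : μ s - ((k : ℝ≥0∞) + 1)⁻¹ < μ s :=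
      ENNReal.sub_lt_self (measure_ne_top _ _) h0 (by simp)
    obtain ⟨K, hKs, hK, hle⟩ := exists_isCompact_le_measure_of_analyticSet hs hlt
    exact ⟨K, hKs, hK.measurableSet, tsub_le_iff_right.1 hle⟩
  choose K hKs hK hle using this
  have hU : μ s ≤ μ (⋃ k, K k) := by
    refine ENNReal.le_of_forall_pos_le_add fun ε hε _ => ?_
    obtain ⟨k, hk⟩ := ENNReal.exists_inv_nat_lt (a := ε) (by simpa using hε.ne')
    refine (hle k).trans ?_
    gcongr
    · exact subset_iUnion K k
    · refine le_trans ?_ hk.le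
      exact ENNReal.inv_le_inv.2 le_self_add
  refine ⟨⋃ k, K k, MeasurableSet.iUnion hK, ?_⟩
  have hsub : ⋃ k, K k ⊆ s := iUnion_subset hKs
  exact (ae_eq_of_subset_of_measure_ge hsub hU (MeasurableSet.iUnion hK).nullMeasurableSet
    (measure_ne_top _ _)).symm

end Analytic

/-! ### Analyticity of the rays and of the transport set. -/

section Measurability

variable {X : Type*} [MetricSpace X] [PolishSpace X] [MeasurableSpace X] [BorelSpace X]
  {dL : X → X → ℝ≥0∞} {Γ : Set (X × X)}

theorem IsRaySpace.measurable (h : IsRaySpace dL) {Ω : Type*} [MeasurableSpace Ω] {f g : Ω → X}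
    (hf : Measurable f) (hg : Measurable g) : Measurable fun x => dL (f x) (g x) :=
  h.lowerSemicontinuous.measurable.comp (hf.prodMk hg)

theorem IsMonotoneCarrier.measurableSet {π : Measure (X × X)} (hΓ : IsMonotoneCarrier dL π Γ) :
    MeasurableSet Γ := by
  obtain ⟨K, -, hK, -, rfl⟩ := hΓ.exhaustion
  exact MeasurableSet.iUnion fun k => (hK k).measurableSet

/-- The set of oriented transport rays is analytic. -/
theorem analyticSet_orientedRays (h : IsRaySpace dL) (hΓ : MeasurableSet Γ) :
    AnalyticSet (orientedRays dL Γ) := by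
  have : orientedRays dL Γ = ⋃ I : ℕ, (fun q : ((Fin (I + 1) → X) × (Fin (I + 1) → X)) × X × X =>
      q.2) '' {q | (∀ i, (q.1.1 i, q.1.2 i) ∈ Γ) ∧
        ∑ i, dL (q.1.1 (i + 1)) (q.1.2 i) = ∑ i, dL (q.1.1 i) (q.1.2 i) ∧
        dL (q.1.1 0) q.2.1 + dL q.2.1 q.2.2 + dL q.2.2 (q.1.2 (Fin.last I)) =
          dL (q.1.1 0) (q.1.2 (Fin.last I))} := by
    ext ⟨x, y⟩
    simp only [mem_iUnion, mem_image, mem_ofPred_eq]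
    constructor
    · rintro ⟨⟨a, b⟩, ⟨I, w, z, hΓ, rfl, rfl, hs⟩, hle⟩
      exact ⟨I, ((w, z), (x, y)), ⟨hΓ, hs, hle⟩, rfl⟩
    · rintro ⟨I, ⟨⟨w, z⟩, ⟨x', y'⟩⟩, ⟨hΓ, hs, hle⟩, he⟩
      obtain ⟨rfl, rfl⟩ := Prod.mk.inj he
      exact ⟨(w 0, z (Fin.last I)), ⟨I, w, z, hΓ, rfl, rfl, hs⟩, hle⟩
  rw [this]
  refine AnalyticSet.iUnion fun I => MeasurableSet.analyticSet_image ?_ measurable_snd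
  have m1 : ∀ i, Measurable fun q : ((Fin (I + 1) → X) × (Fin (I + 1) → X)) × X × X => q.1.1 i :=
    fun i => (measurable_pi_apply i).comp (measurable_fst.comp measurable_fst)
  have m2 : ∀ i, Measurable fun q : ((Fin (I + 1) → X) × (Fin (I + 1) → X)) × X × X => q.1.2 i :=
    fun i => (measurable_pi_apply i).comp (measurable_snd.comp measurable_fst)
  have m3 : Measurable fun q : ((Fin (I + 1) → X) × (Fin (I + 1) → X)) × X × X => q.2.1 :=
    measurable_fst.comp measurable_snd
  have m4 : Measurable fun q : ((Fin (I + 1) → X) × (Fin (I + 1) → X)) × X × X => q.2.2 :=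
    measurable_snd.comp measurable_snd
  rw [ofPred_and, ofPred_and, ofPred_forall]
  refine MeasurableSet.inter ?_ (MeasurableSet.inter ?_ ?_)
  · exact MeasurableSet.iInter fun i => ((m1 i).prodMk (m2 i)) hΓ
  · exact measurableSet_eq_fun (Finset.measurable_sum _ fun i _ => h.measurable (m1 _) (m2 _))
      (Finset.measurable_sum _ fun i _ => h.measurable (m1 _) (m2 _))
  · exact measurableSet_eq_fun (((h.measurable (m1 _) m3).add (h.measurable m3 m4)).add
      (h.measurable m4 (m2 _))) (h.measurable (m1 _) (m2 _))

theorem analyticSet_inter {α : Type*} [TopologicalSpace α] [T2Space α] {s t : Set α}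
    (hs : AnalyticSet s) (ht : AnalyticSet t) : AnalyticSet (s ∩ t) := by
  rw [inter_eq_iInter]
  exact AnalyticSet.iInter fun b => by cases b <;> assumption

theorem analyticSet_transportSet (h : IsRaySpace dL) (hΓ : MeasurableSet Γ) :
    AnalyticSet (transportSet dL Γ) := by
  have hG := analyticSet_orientedRays h hΓ
  have hne : AnalyticSet {p : X × X | p.1 ≠ p.2} :=
    (measurableSet_eq_fun measurable_fst measurable_snd).compl.analyticSet
  have hI : AnalyticSet (orientedRays dL Γ ∩ {p : X × X | p.1 ≠ p.2}) := analyticSet_inter hG hne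
  have : transportSet dL Γ = ⋂ b : Bool, cond b
      (Prod.snd '' (orientedRays dL Γ ∩ {p : X × X | p.1 ≠ p.2}))
      (Prod.fst '' (orientedRays dL Γ ∩ {p : X × X | p.1 ≠ p.2})) := by
    rw [← inter_eq_iInter]
    ext x
    simp [transportSet, and_comm, eq_comm]
  rw [this]
  refine AnalyticSet.iInter fun b => ?_
  cases b
  · exact hI.image_of_continuous continuous_fst
  · exact hI.image_of_continuous continuous_snd

end Measurability

/-! ### Ray coordinates and slices with few inner distances. -/

section RayCoordinates

theorem volume_preimage_const_sub (c : ℝ) (s : Set ℝ) :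
    volume ((fun t => c - t) ⁻¹' s) = volume s :=
  (Measure.measurePreserving_sub_left volume c).measure_preimage_equiv
    (f := MeasurableEquiv.subLeft c) s

theorem volume_le_of_forall_inter_Iic_le {σ : Set ℝ} {c : ℝ≥0∞} (hσ : BddAbove σ)
    (h : ∀ s ∈ σ, volume (σ ∩ Iic s) ≤ c) : volume σ ≤ c := by
  rcases σ.eq_empty_or_nonempty with rfl | hne
  · simp
  obtain ⟨u, humono, hulim, hu⟩ := exists_seq_tendsto_sSup hne hσ
  have h1 : volume (⋃ n, σ ∩ Iic (u n)) ≤ c := by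
    rw [Monotone.measure_iUnion fun m n hmn =>
      inter_subset_inter_right _ (Iic_subset_Iic.2 (humono hmn))]
    exact iSup_le fun n => h _ (hu n)
  calc volume σ ≤ volume ((⋃ n, σ ∩ Iic (u n)) ∪ {sSup σ}) := by
        refine measure_mono fun s hs => ?_
        rcases (le_csSup hσ hs).lt_or_eq with hlt | heq
        · obtain ⟨n, hn⟩ := (hulim.eventually (lt_mem_nhds hlt)).exists
          exact Or.inl (mem_iUnion.2 ⟨n, hs, hn.le⟩)
        · exact Or.inr heq
    _ ≤ volume (⋃ n, σ ∩ Iic (u n)) + volume {sSup σ} := measure_union_le _ _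
    _ ≤ c := by simpa using h1

variable {X : Type*} {dL : X → X → ℝ≥0∞} {Γ : Set (X × X)} {f : X → X}

theorem transportSet_subset : transportSet dL Γ ⊆ transportSetE dL Γ := fun _ hx => Or.inl hx.1

theorem rayCoord_eq (x : X) : rayCoord dL Γ f x = (f x, rayPosition dL Γ (f x) x) := rfl

/-- The distances `d_L x v` from a point `v` to the points `x` of `S` that precede it on its ray,
where `x` is preceded, and `v` is followed, by a point of `S` at distance at least `η`. -/
def innerDistances (dL : X → X → ℝ≥0∞) (Γ : Set (X × X)) (S : Set X) (η : ℝ) (v : X) : Set ℝ :=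
  {t | ∃ p ∈ S, ∃ x ∈ S, ∃ q ∈ S, (p, x) ∈ orientedRays dL Γ ∧ (x, v) ∈ orientedRays dL Γ ∧
    (v, q) ∈ orientedRays dL Γ ∧ (dL x v).toReal = t ∧ η ≤ (dL p x).toReal ∧ η ≤ (dL v q).toReal}

variable [MetricSpace X]

theorem rayPosition_sub_eq (h : IsRaySpace dL) (hm : IsCyclicallyMonotone dL Γ)
    (hf : ∀ p ∈ Γ, dL p.1 p.2 ≠ ⊤) (hcs : IsCrossSection dL Γ f) {x z : X}
    (hx : x ∈ transportSet dL Γ) (hz : z ∈ transportSet dL Γ) (hG : (x, z) ∈ orientedRays dL Γ) :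
    f x = f z ∧
      rayPosition dL Γ (f z) x = rayPosition dL Γ (f z) z - (dL x z).toReal := by
  have hfe := hcs.eq_of_rel x hx z hz (Or.inl hG)
  refine ⟨hfe, ?_⟩
  have h1 : (f z, x) ∈ rays dL Γ := hfe ▸ (hcs.rel x hx).symm
  have h2 : (f z, z) ∈ rays dL Γ := (hcs.rel z hz).symm
  rcases le_total (rayPosition dL Γ (f z) x) (rayPosition dL Γ (f z) z) with hle | hle
  · linarith [(rayPosition_spec h hm hf (hcs.mapsTo hz) h1 h2 hle).2]
  · have := orientedRays_antisymm h hm hf hG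
      (rayPosition_spec h hm hf (hcs.mapsTo hz) h2 h1 hle).1
    subst this
    simp [h.self]

theorem orientedRays_of_rayPosition_le (h : IsRaySpace dL) (hm : IsCyclicallyMonotone dL Γ)
    (hf : ∀ p ∈ Γ, dL p.1 p.2 ≠ ⊤) (hcs : IsCrossSection dL Γ f) {x z : X}
    (hx : x ∈ transportSet dL Γ) (hz : z ∈ transportSet dL Γ) (hfe : f x = f z)
    (hle : rayPosition dL Γ (f x) x ≤ rayPosition dL Γ (f z) z) :
    (x, z) ∈ orientedRays dL Γ ∧
      (dL x z).toReal = rayPosition dL Γ (f z) z - rayPosition dL Γ (f x) x := by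
  have h1 : (f z, x) ∈ rays dL Γ := hfe ▸ (hcs.rel x hx).symm
  have h2 : (f z, z) ∈ rays dL Γ := (hcs.rel z hz).symm
  rw [hfe] at hle ⊢
  exact rayPosition_spec h hm hf (hcs.mapsTo hz) h1 h2 hle

theorem injOn_rayCoord (h : IsRaySpace dL) (hm : IsCyclicallyMonotone dL Γ)
    (hf : ∀ p ∈ Γ, dL p.1 p.2 ≠ ⊤) (hcs : IsCrossSection dL Γ f) :
    InjOn (rayCoord dL Γ f) (transportSet dL Γ) := by
  intro x hx z hz heq
  rw [rayCoord_eq, rayCoord_eq, Prod.mk.injEq] at heq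
  have := orientedRays_of_rayPosition_le h hm hf hcs hx hz heq.1 heq.2.le
  refine h.eq_of_toReal_le_zero (ne_top_of_mem_orientedRays h hf this.1) ?_
  rw [this.2, heq.2, sub_self]

/-- A set of points with few inner distances has small slices along the rays. -/
theorem volume_slice_le (h : IsRaySpace dL) (hm : IsCyclicallyMonotone dL Γ)
    (hf : ∀ p ∈ Γ, dL p.1 p.2 ≠ ⊤) (hcs : IsCrossSection dL Γ f) {S S' : Set X} (hS : S' ⊆ S)
    {M η : ℝ} (hη : 0 < η) (hM : ∀ u ∈ S, ∀ v ∈ S, (dL u v).toReal ≤ M)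
    (hD : ∀ v ∈ S', volume (innerDistances dL Γ S η v) ≤ ENNReal.ofReal η) (y : X) :
    volume {s | ∃ x ∈ S' ∩ transportSet dL Γ, f x = y ∧ rayPosition dL Γ y x = s} ≤
      ENNReal.ofReal (5 * η) := by
  set σ := {s | ∃ x ∈ S' ∩ transportSet dL Γ, f x = y ∧ rayPosition dL Γ y x = s} with hσ
  have key : ∀ s ∈ σ, ∃ x ∈ S', x ∈ transportSet dL Γ ∧ f x = y ∧ rayPosition dL Γ (f x) x = s := by
    rintro s ⟨x, hx, rfl, rfl⟩
    exact ⟨x, hx.1, hx.2, rfl, rfl⟩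
  have hlen : ∀ s ∈ σ, ∀ s' ∈ σ, s' ≤ s + M := by
    intro s hs s' hs'
    obtain ⟨x, hx, hxT, hfx, rfl⟩ := key s hs
    obtain ⟨x', hx', hxT', hfx', rfl⟩ := key s' hs'
    have hM' := hM x (hS hx) x' (hS hx')
    rcases le_total (rayPosition dL Γ (f x) x) (rayPosition dL Γ (f x') x') with hle | hle
    · rw [(orientedRays_of_rayPosition_le h hm hf hcs hxT hxT' (hfx.trans hfx'.symm) hle).2] at hM'
      linarith
    · have := ENNReal.toReal_nonneg (a := dL x x')
      linarith
  rcases σ.eq_empty_or_nonempty with he | ⟨s₀, hs₀⟩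
  · rw [he]; simp
  have hbb : BddBelow σ := ⟨s₀ - M, fun s hs => by linarith [hlen s hs s₀ hs₀]⟩
  have hba : BddAbove σ := ⟨s₀ + M, fun s hs => hlen s₀ hs₀ s hs⟩
  set a := sInf σ
  set b := sSup σ
  -- There are points `p`, `q` of the slice within `η` of its two ends. Relative to a point `v` at a
  -- position `s` in the middle part, every earlier point of the middle part has `p` at least `η`
  -- before it, and `q` is at least `η` after `v`. So the differences from `s` are inner distances
  -- of `v`.
  have h0 : volume (σ ∩ Icc (a + 2 * η) (b - 2 * η)) ≤ ENNReal.ofReal η := by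
    refine volume_le_of_forall_inter_Iic_le (hba.mono inter_subset_left) ?_
    rintro s ⟨hs, hsa, hsb⟩
    obtain ⟨v, hv, hvT, hfv, hvs⟩ := key s hs
    obtain ⟨q', hq'σ, hq'⟩ := exists_lt_of_lt_csSup ⟨s₀, hs₀⟩ (show b - η < b by linarith)
    obtain ⟨q, hq, hqT, hfq, hqs⟩ := key q' hq'σ
    obtain ⟨p', hp'σ, hp'⟩ := exists_lt_of_csInf_lt ⟨s₀, hs₀⟩ (show a < a + η by linarith)
    obtain ⟨p, hp, hpT, hfp, hps⟩ := key p' hp'σ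
    have hvq := orientedRays_of_rayPosition_le h hm hf hcs hvT hqT (hfv.trans hfq.symm)
      (by rw [hvs, hqs]; linarith)
    refine le_trans ?_ (hD v hv)
    rw [← volume_preimage_const_sub s]
    refine measure_mono ?_
    rintro t ⟨⟨htσ, hta, htb⟩, hts⟩
    rw [mem_Iic] at hts
    obtain ⟨x, hx, hxT, hfx, hxs⟩ := key _ htσ
    have hxv := orientedRays_of_rayPosition_le h hm hf hcs hxT hvT (hfx.trans hfv.symm)
      (by rw [hxs, hvs]; exact hts)
    have hpx := orientedRays_of_rayPosition_le h hm hf hcs hpT hxT (hfp.trans hfx.symm)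
      (by rw [hps, hxs]; linarith)
    refine ⟨p, hS hp, x, hS hx, q, hS hq, hpx.1, hxv.1, hvq.1, ?_, ?_, ?_⟩
    · rw [hxv.2, hvs, hxs]; ring
    · rw [hpx.2, hxs, hps]; linarith
    · rw [hvq.2, hqs, hvs]; linarith
  -- The two discarded ends have length `2η` each and the middle contributes at most `η`.
  calc volume σ ≤ volume (Icc a (a + 2 * η) ∪ (σ ∩ Icc (a + 2 * η) (b - 2 * η)) ∪
        Icc (b - 2 * η) b) := by
        refine measure_mono fun s hs => ?_
        have h1 := csInf_le hbb hs
        have h2 := le_csSup hba hs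
        by_cases h3 : s ≤ a + 2 * η
        · exact Or.inl (Or.inl ⟨h1, h3⟩)
        by_cases h4 : s ≤ b - 2 * η
        · exact Or.inl (Or.inr ⟨hs, (not_le.1 h3).le, h4⟩)
        · exact Or.inr ⟨(not_le.1 h4).le, h2⟩
    _ ≤ volume (Icc a (a + 2 * η)) + volume (σ ∩ Icc (a + 2 * η) (b - 2 * η)) +
        volume (Icc (b - 2 * η) b) :=
      (measure_union_le _ _).trans (by gcongr; exact measure_union_le _ _)
    _ ≤ ENNReal.ofReal (2 * η) + ENNReal.ofReal η + ENNReal.ofReal (2 * η) := by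
        rw [Real.volume_Icc, Real.volume_Icc]
        gcongr <;> linarith
    _ = ENNReal.ofReal (5 * η) := by
        rw [← ENNReal.ofReal_add (by linarith) hη.le, ← ENNReal.ofReal_add (by linarith)
          (by linarith)]
        congr 1; ring

end RayCoordinates

/-! ### Consequences of absolute continuity on one space. -/

section SingleSpace

theorem measure_diagonal_eq_zero {X : Type*} [MeasurableSpace X] {π : Measure (X × X)}
    (hsing : π.map Prod.fst ⟂ₘ π.map Prod.snd) : π {p | p.1 = p.2} = 0 := by
  obtain ⟨s, hs, h1, h2⟩ := hsing
  rw [Measure.map_apply measurable_fst hs] at h1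
  rw [Measure.map_apply measurable_snd hs.compl] at h2
  refine measure_mono_null (fun p hp => ?_) (measure_union_null h1 h2)
  rw [mem_ofPred_eq] at hp
  by_cases hps : p.1 ∈ s
  · exact Or.inl hps
  · exact Or.inr fun h => hps (hp ▸ h)

variable {X : Type*} [MetricSpace X] [PolishSpace X] [MeasurableSpace X] [BorelSpace X]
  {dL : X → X → ℝ≥0∞} {Γ : Set (X × X)} {f : X → X}

/-- The set of the points from which a pair of `Γ` starts that is not on the diagonal. -/
theorem analyticSet_movedSources {π : Measure (X × X)} (hΓ : IsMonotoneCarrier dL π Γ) :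
    AnalyticSet {x | ∃ z, z ≠ x ∧ (x, z) ∈ Γ} := by
  have : {x | ∃ z, z ≠ x ∧ (x, z) ∈ Γ} = Prod.fst '' (Γ ∩ {p | p.1 ≠ p.2}) := by
    ext x
    simp [and_comm, eq_comm]
  rw [this]
  exact (hΓ.measurableSet.inter (measurableSet_eq_fun measurable_fst
    measurable_snd).compl).analyticSet.image_of_continuous continuous_fst

theorem ae_exists_moved {π : Measure (X × X)} [IsFiniteMeasure π]
    (hdiag : π {p | p.1 = p.2} = 0) (hΓ : IsMonotoneCarrier dL π Γ) :
    ∀ᵐ x ∂(π.map Prod.fst), ∃ z, z ≠ x ∧ (x, z) ∈ Γ := by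
  have hn : NullMeasurableSet {x | ∃ z, z ≠ x ∧ (x, z) ∈ Γ} (π.map Prod.fst) :=
    nullMeasurableSet_of_analyticSet (analyticSet_movedSources hΓ)
  rw [ae_iff, ← compl_ofPred, Measure.map_apply₀ measurable_fst.aemeasurable hn.compl]
  refine measure_mono_null (fun p hp => ?_) (measure_union_null hΓ.concentrated hdiag)
  by_contra hcon
  simp only [mem_union, mem_compl_iff, not_or, not_not, mem_ofPred_eq] at hcon
  exact hp ⟨p.2, Ne.symm hcon.2, hcon.1⟩

/-- Under the absolute continuity assumption, a Borel set is null if almost every point is a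
translate of its points for a null set of times only. -/
theorem AbsContAlongRays.measure_eq_zero (h : IsRaySpace dL) (hm : IsCyclicallyMonotone dL Γ)
    (hf : ∀ p ∈ Γ, dL p.1 p.2 ≠ ⊤) (hΓ : MeasurableSet Γ) (hcs : IsCrossSection dL Γ f)
    {μ : Measure X} [IsFiniteMeasure μ] (habs : AbsContAlongRays dL Γ f μ) {A : Set X}
    (hA : MeasurableSet A) (hAT : A ⊆ transportSetE dL Γ)
    (hz : ∀ᵐ z ∂μ, volume {t : ℝ | 0 < t ∧ ∃ x ∈ A, (x, z) ∈ orientedRays dL Γ ∧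
      (dL x z).toReal = t} = 0) : μ A = 0 := by
  by_contra hne
  have hpos := habs A hA hAT (pos_iff_ne_zero.2 hne)
  refine hpos.ne' (lintegral_eq_zero_of_ae_eq_zero ?_)
  -- A finite measure with the null sets of Lebesgue measure on the half-line, so that the analytic
  -- set `N` is measurable for the completed product measure.
  set ν := (volume.restrict (Ioi (0 : ℝ))).toFinite
  have hνac : volume.restrict (Ioi (0 : ℝ)) ≪ ν := absolutelyContinuous_toFinite _
  have hνac' : ν ≪ volume.restrict (Ioi (0 : ℝ)) := toFinite_absolutelyContinuous _
  set N : Set (ℝ × X) := {q | ∃ x ∈ A, (x, q.2) ∈ orientedRays dL Γ ∧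
    (dL x q.2).toReal = q.1} with hN
  have hNan : AnalyticSet N := by
    have : N = (fun q : X × ℝ × X => q.2) ''
        ((fun q : X × ℝ × X => (q.1, q.2.2)) ⁻¹' orientedRays dL Γ ∩
          (Prod.fst ⁻¹' A ∩ {q | (dL q.1 q.2.2).toReal = q.2.1})) := by
      ext q
      constructor
      · rintro ⟨x, hx, h1, h2⟩
        exact ⟨(x, q), ⟨h1, hx, h2⟩, rfl⟩
      · rintro ⟨⟨x, q⟩, ⟨h1, hx, h2⟩, rfl⟩
        exact ⟨x, hx, h1, h2⟩
    rw [this]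
    refine AnalyticSet.image_of_continuous ?_ continuous_snd
    refine analyticSet_inter ((analyticSet_orientedRays h hΓ).preimage (by fun_prop)) ?_
    refine MeasurableSet.analyticSet ?_
    refine (measurable_fst hA).inter (measurableSet_eq_fun ?_ (by fun_prop))
    exact (h.measurable (by fun_prop) (by fun_prop)).ennreal_toReal
  have hNn : NullMeasurableSet N (ν.prod μ) := nullMeasurableSet_of_analyticSet hNan
  have hN0 : (ν.prod μ) N = 0 := by
    obtain ⟨N', hN'N, hN'm, hN'e⟩ := hNn.exists_measurable_subset_ae_eq
    rw [← measure_congr hN'e, Measure.prod_apply_symm hN'm]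
    refine lintegral_eq_zero_of_ae_eq_zero ?_
    filter_upwards [hz] with z hz
    refine hνac' ?_
    rw [Measure.restrict_apply (measurable_prodMk_right hN'm)]
    refine measure_mono_null (fun t ht => ?_) hz
    obtain ⟨x, hx, h1, h2⟩ := hN'N ht.1
    exact ⟨ht.2, x, hx, h1, h2⟩
  have hN0' : ∀ᵐ q ∂(ν.prod μ), q ∉ N := measure_eq_zero_iff_ae_notMem.1 hN0
  have := hνac.ae_le (Measure.ae_ae_of_ae_prod hN0')
  filter_upwards [this, ae_restrict_mem measurableSet_Ioi] with t ht ht0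
  refine measure_mono_null (translate_subset h hm hf hcs ht0) ?_
  rw [measure_eq_zero_iff_ae_notMem]
  exact ht

/-- A moved point outside `𝒯` is an initial point. Since a moved point `z` has a ray continuing
after it, its predecessors are linearly ordered, so at most one of them is initial. Each such `z` is
then reached from initial points at no more than one time, and absolute continuity makes the initial
points null. -/
theorem ae_mem_transportSet (h : IsRaySpace dL) (hm : IsCyclicallyMonotone dL Γ)
    (hf : ∀ p ∈ Γ, dL p.1 p.2 ≠ ⊤) (hΓ : MeasurableSet Γ) (hcs : IsCrossSection dL Γ f)
    {μ : Measure X} [IsFiniteMeasure μ] (habs : AbsContAlongRays dL Γ f μ)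
    (hmoved : ∀ᵐ x ∂μ, ∃ z, z ≠ x ∧ (x, z) ∈ Γ) : ∀ᵐ x ∂μ, x ∈ transportSet dL Γ := by
  have hE : ∀ x, (∃ z, z ≠ x ∧ (x, z) ∈ Γ) → ∃ z, z ≠ x ∧ (x, z) ∈ orientedRays dL Γ := by
    rintro x ⟨z, hzx, hz⟩
    exact ⟨z, hzx, (x, z), subset_cycleSet hz, by simp [h.self]⟩
  have hT : NullMeasurableSet (transportSet dL Γ) μ :=
    nullMeasurableSet_of_analyticSet (analyticSet_transportSet h hΓ)
  obtain ⟨E, hEs, hEm, hEe⟩ := (show NullMeasurableSet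
    {x | ∃ z, z ≠ x ∧ (x, z) ∈ Γ} μ from .of_compl (.of_null hmoved)).exists_measurable_subset_ae_eq
  have hEae : ∀ᵐ x ∂μ, x ∈ E := by
    filter_upwards [hmoved, hEe.mem_iff] with x hx hxe
    exact hxe.2 hx
  obtain ⟨A', hA's, hA'm, hA'e⟩ := hT.compl.exists_measurable_subset_ae_eq
  have key : μ (A' ∩ E) = 0 := by
    refine habs.measure_eq_zero h hm hf hΓ hcs (hA'm.inter hEm)
      (fun x hx => Or.inr (hE x (hEs hx.2))) ?_
    filter_upwards [hmoved] with z hz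
    obtain ⟨q, hqz, hq⟩ := hE z hz
    refine Subsingleton.measure_zero ?_ _
    have hinit : ∀ x ∈ A' ∩ E, ∀ w, (w, x) ∈ orientedRays dL Γ → w = x := by
      intro x hx w hw
      by_contra hne
      exact hA's hx.1 ⟨⟨w, hne, hw⟩, hE x (hEs hx.2)⟩
    rintro t ⟨-, x, hx, hG, rfl⟩ t' ⟨-, x', hx', hG', rfl⟩
    rcases le_total (dL x z).toReal (dL x' z).toReal with hle | hle
    · rw [hinit x hx x' (orientedRays_comparable_left h hm hf hqz.symm hq hG hG' hle).1]
    · rw [hinit x' hx' x (orientedRays_comparable_left h hm hf hqz.symm hq hG' hG hle).1]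
  filter_upwards [measure_eq_zero_iff_ae_notMem.1 key, hEae, hA'e.mem_iff] with x h1 h2 h3
  by_contra h4
  exact h1 ⟨h3.2 h4, h2⟩

/-- On a Borel set of full measure, the inverse of the ray map coincides with a Borel map. -/
theorem exists_measurable_eqOn_rayCoord (h : IsRaySpace dL) (hm : IsCyclicallyMonotone dL Γ)
    (hf : ∀ p ∈ Γ, dL p.1 p.2 ≠ ⊤) (hΓ : MeasurableSet Γ) (hcs : IsCrossSection dL Γ f)
    {μ : Measure X} (hT : ∀ᵐ x ∂μ, x ∈ transportSet dL Γ) (hfm : AEMeasurable f μ) :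
    ∃ W ⊆ transportSet dL Γ, MeasurableSet W ∧ μ Wᶜ = 0 ∧ ∃ φ : X → X × ℝ, Measurable φ ∧
      EqOn (rayCoord dL Γ f) φ W := by
  have hG := analyticSet_orientedRays h hΓ
  have hne : AnalyticSet {p : X × X | p.1 ≠ p.2} :=
    (measurableSet_eq_fun measurable_fst measurable_snd).compl.analyticSet
  -- Off the diagonal, `G` and its reverse are analytic and, by antisymmetry, disjoint. A Borel set
  -- separating them decides the sign of the coordinate; at `f x = x` the coordinate is `0` either
  -- way.
  obtain ⟨B, hGB, hBG, hB⟩ : MeasurablySeparable (orientedRays dL Γ ∩ {p : X × X | p.1 ≠ p.2})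
      (Prod.swap ⁻¹' orientedRays dL Γ ∩ {p : X × X | p.1 ≠ p.2}) := by
    refine (analyticSet_inter hG hne).measurablySeparable
      (analyticSet_inter (hG.preimage continuous_swap) hne) ?_
    rw [Set.disjoint_left]
    rintro ⟨x, y⟩ ⟨h1, h2⟩ ⟨h3, -⟩
    exact h2 (orientedRays_antisymm h hm hf h1 h3)
  obtain ⟨W, hWs, hWm, hW⟩ : ∃ W ⊆ {x | x ∈ transportSet dL Γ ∧ f x = hfm.mk f x},
      MeasurableSet W ∧ μ Wᶜ = 0 := by
    have : ∀ᵐ x ∂μ, x ∈ transportSet dL Γ ∧ f x = hfm.mk f x := hT.and hfm.ae_eq_mk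
    refine ⟨(toMeasurable μ {x | ¬ (x ∈ transportSet dL Γ ∧ f x = hfm.mk f x)})ᶜ, ?_,
      (measurableSet_toMeasurable _ _).compl, ?_⟩
    · rw [compl_subset_comm, compl_ofPred]
      exact subset_toMeasurable _ _
    · rw [compl_compl, measure_toMeasurable]
      exact this
  classical
  refine ⟨W, fun x hx => (hWs hx).1, hWm, hW,
    fun x => (hfm.mk f x, if (hfm.mk f x, x) ∈ B then (dL x (hfm.mk f x)).toReal
      else -(dL x (hfm.mk f x)).toReal), ?_, fun x hx => ?_⟩
  · have h1 := hfm.measurable_mk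
    have h2 := (h.measurable measurable_id h1).ennreal_toReal
    exact h1.prodMk (Measurable.ite ((h1.prodMk measurable_id) hB) h2 h2.neg)
  · obtain ⟨hxT, hfx⟩ := hWs hx
    rw [rayCoord_eq, rayPosition]
    dsimp only
    rw [← hfx]
    refine Prod.ext rfl ?_
    dsimp only
    by_cases hxf : f x = x
    · rw [hxf, h.self]; simp
    rcases hcs.rel x hxT with hR | hR
    · have h1 : (f x, x) ∉ orientedRays dL Γ := fun h1 => hxf (orientedRays_antisymm h hm hf h1 hR)
      have h2 : (f x, x) ∉ B := fun h2 => Set.disjoint_left.1 hBG ⟨hR, hxf⟩ h2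
      rw [if_neg h1, if_neg h2]
    · have h2 : (f x, x) ∈ B := hGB ⟨hR, hxf⟩
      rw [if_pos h2, if_pos]
      exact hR

/-- The image of `μ` under the inverse of the ray map is absolutely continuous with respect to
`m ⊗ ℒ¹`. -/
theorem absolutelyContinuous_map_rayCoord (h : IsRaySpace dL) (hm : IsCyclicallyMonotone dL Γ)
    (hf : ∀ p ∈ Γ, dL p.1 p.2 ≠ ⊤) (hΓ : MeasurableSet Γ) (hcs : IsCrossSection dL Γ f)
    {μ : Measure X} [IsFiniteMeasure μ] (habs : AbsContAlongRays dL Γ f μ)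
    (hT : ∀ᵐ x ∂μ, x ∈ transportSet dL Γ) (hfm : AEMeasurable f μ) :
    μ.map (rayCoord dL Γ f) ≪ (μ.map f).prod volume := by
  obtain ⟨W, hWT, hWm, hW0, φ, hφ, hφW⟩ := exists_measurable_eqOn_rayCoord h hm hf hΓ hcs hT hfm
  have hWae : ∀ᵐ x ∂μ, x ∈ W := hW0
  have hae : rayCoord dL Γ f =ᵐ[μ] φ := by
    filter_upwards [hWae] with x hx using hφW hx
  refine Measure.AbsolutelyContinuous.mk fun N hN hN0 => ?_
  rw [Measure.map_congr hae, Measure.map_apply hφ hN]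
  -- By Fubini almost every `z` sits on a ray whose slice of `N` is null; reflecting this slice at
  -- the position of `z` covers the times at which `z` is reached.
  have hslice := ae_of_ae_map hfm (Measure.measure_ae_null_of_prod_null hN0)
  have : μ (W ∩ φ ⁻¹' N) = 0 := by
    refine habs.measure_eq_zero h hm hf hΓ hcs (hWm.inter (hφ hN))
      (fun x hx => transportSet_subset (hWT hx.1)) ?_
    filter_upwards [hslice, hWae] with z hz hzW
    refine measure_mono_null ?_ ((volume_preimage_const_sub (rayPosition dL Γ (f z) z) _).trans hz)
    rintro t ⟨ht, x, ⟨hxW, hxN⟩, hG, rfl⟩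
    have := rayPosition_sub_eq h hm hf hcs (hWT hxW) (hWT hzW) hG
    rw [mem_preimage, ← hφW hxW, rayCoord_eq, this.1, this.2] at hxN
    exact hxN
  refine le_antisymm (le_trans (measure_mono fun x hx => ?_) (measure_union_null this hW0).le)
    zero_le
  by_cases hxW : x ∈ W
  exacts [Or.inl ⟨hxW, hx⟩, Or.inr hxW]

/-- A set with small slices along the rays has small measure. -/
theorem measure_lt_of_slices_le (h : IsRaySpace dL) (hm : IsCyclicallyMonotone dL Γ)
    (hf : ∀ p ∈ Γ, dL p.1 p.2 ≠ ⊤) (hΓ : MeasurableSet Γ) (hcs : IsCrossSection dL Γ f)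
    {μ : Measure X} [IsProbabilityMeasure μ] (habs : AbsContAlongRays dL Γ f μ)
    (hT : ∀ᵐ x ∂μ, x ∈ transportSet dL Γ)
    (hfm : AEMeasurable f (μ.restrict (transportSet dL Γ))) {δ ε κ : ℝ≥0∞}
    (hequi : ∀ A : Set (X × ℝ), MeasurableSet A → rayReference dL Γ f μ A < δ →
      ∫⁻ p in A, rayDensity dL Γ f μ p ∂(rayReference dL Γ f μ) < ε) (hκ : κ < δ)
    {S : Set X} (hS : MeasurableSet S)
    (hslice : ∀ y, volume {s | ∃ x ∈ S ∩ transportSet dL Γ, f x = y ∧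
      rayPosition dL Γ y x = s} ≤ κ) : μ S < ε := by
  have hres : μ.restrict (transportSet dL Γ) = μ := Measure.restrict_eq_self_of_ae_mem hT
  rw [hres] at hfm
  have hac := absolutelyContinuous_map_rayCoord h hm hf hΓ hcs habs hT hfm
  obtain ⟨W, hWT, hWm, hW0, φ, hφ, hφW⟩ := exists_measurable_eqOn_rayCoord h hm hf hΓ hcs hT hfm
  have hae : rayCoord dL Γ f =ᵐ[μ] φ := by
    have hWae : ∀ᵐ x ∂μ, x ∈ W := hW0
    filter_upwards [hWae] with x hx using hφW hx
  -- By injectivity of the ray coordinates: an injective Borel image of a Borel set is Borel.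
  have hB : MeasurableSet (φ '' (S ∩ W)) := by
    refine (hS.inter hWm).image_of_measurable_injOn hφ ?_
    refine InjOn.mono inter_subset_right ?_
    exact ((injOn_rayCoord h hm hf hcs).mono hWT).congr hφW
  have : IsProbabilityMeasure (μ.map f) := Measure.isProbabilityMeasure_map hfm
  have href : rayReference dL Γ f μ = (μ.map f).prod volume := by
    rw [rayReference, quotientMeasure, hres]
  have hlt : rayReference dL Γ f μ (φ '' (S ∩ W)) < δ := by
    refine lt_of_le_of_lt ?_ hκ
    rw [href, Measure.prod_apply hB]
    calc ∫⁻ y, volume (Prod.mk y ⁻¹' (φ '' (S ∩ W))) ∂(μ.map f) ≤ ∫⁻ _, κ ∂(μ.map f) := by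
          refine lintegral_mono fun y => (measure_mono ?_).trans (hslice y)
          rintro s ⟨x, ⟨hxS, hxW⟩, hx⟩
          rw [← hφW hxW, rayCoord_eq, Prod.mk.injEq] at hx
          obtain ⟨rfl, rfl⟩ := hx
          exact ⟨x, ⟨hxS, hWT hxW⟩, rfl, rfl⟩
      _ = κ := by simp
  have := hequi _ hB hlt
  rw [rayDensity, href, hres, Measure.setLIntegral_rnDeriv hac, Measure.map_congr hae,
    Measure.map_apply hφ hB] at this
  refine lt_of_le_of_lt ?_ this
  calc μ S ≤ μ (S ∩ W ∪ Wᶜ) := measure_mono fun x hx => by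
        by_cases hxW : x ∈ W
        exacts [Or.inl ⟨hx, hxW⟩, Or.inr hxW]
    _ ≤ μ (S ∩ W) + μ Wᶜ := measure_union_le _ _
    _ = μ (S ∩ W) := by rw [hW0, add_zero]
    _ ≤ _ := measure_mono (subset_preimage_image _ _)

end SingleSpace

/-! ### Selecting convergent sequences. -/

section Selection

/-- Points of `Q n` minimizing the distance to `x` up to `1 / (n + 1)` work for all radii at once.
-/
theorem exists_seq_tendsto_of_eventually_exists {W : Type*} [PseudoMetricSpace W] {Z : ℕ → Type*}
    [∀ n, Nonempty (Z n)] {L : ∀ n, Z n → W} {Q : ∀ n, Set (Z n)} {x : W}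
    (h : ∀ r > 0, ∀ᶠ n in atTop, ∃ q ∈ Q n, dist (L n q) x < r) :
    ∃ u : ∀ n, Z n, (∀ᶠ n in atTop, u n ∈ Q n) ∧ Tendsto (fun n => L n (u n)) atTop (𝓝 x) := by
  have hch : ∀ n, ∃ u : Z n, (Q n).Nonempty → u ∈ Q n ∧
      ∀ q ∈ Q n, dist (L n u) x < dist (L n q) x + 1 / ((n : ℝ) + 1) := by
    intro n
    rcases (Q n).eq_empty_or_nonempty with he | hne
    · exact ⟨Classical.arbitrary _, fun h => absurd he h.ne_empty⟩
    have : Nonempty (Q n) := hne.to_subtype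
    have hpos : (0 : ℝ) < 1 / ((n : ℝ) + 1) := Nat.one_div_pos_of_nat
    obtain ⟨⟨u, hu⟩, hlt⟩ := exists_lt_of_ciInf_lt
      (lt_add_of_pos_right (⨅ q : Q n, dist (L n q) x) hpos)
    refine ⟨u, fun _ => ⟨hu, fun q hq => hlt.trans_le ?_⟩⟩
    gcongr
    exact ciInf_le ⟨0, by rintro _ ⟨q, rfl⟩; exact dist_nonneg⟩ (⟨q, hq⟩ : Q n)
  choose u hu using hch
  refine ⟨u, ?_, ?_⟩
  · filter_upwards [h 1 one_pos] with n ⟨q, hq, _⟩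
    exact (hu n ⟨q, hq⟩).1
  · rw [Metric.tendsto_nhds]
    intro ε hε
    have h1 : ∀ᶠ n : ℕ in atTop, 1 / ((n : ℝ) + 1) < ε / 2 :=
      (tendsto_one_div_add_atTop_nhds_zero_nat (𝕜 := ℝ)).eventually (gt_mem_nhds (by linarith))
    filter_upwards [h1, h (ε / 2) (by linarith)] with n hn ⟨q, hq, hqd⟩
    have := (hu n ⟨q, hq⟩).2 q hq
    linarith

end Selection

/-! ### Convergence of the distances near limit points. -/

section Convergence

variable {Y : ℕ → Type*} [∀ n, MeasurableSpace (Y n)] {X : Type*}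

/-- The convergence of structures along the given Borel sets `A n` and maps `l n`. -/
structure ConvergesVia [TopologicalSpace X] [MeasurableSpace X] (dLn : ∀ n, Y n → Y n → ℝ≥0∞)
    (πn : ∀ n, Measure (Y n × Y n)) (dL : X → X → ℝ≥0∞) (π : Measure (X × X))
    (A : ∀ n, Set (Y n)) (l : ∀ n, Y n → X) : Prop where
  measurableSet : ∀ n, MeasurableSet (A n)
  measurable : ∀ n, Measurable (fun x : A n => l n x)
  weak : ∀ φ : X × X →ᵇ ℝ, Tendsto
    (fun n => ∫ p, φ p ∂(((πn n).restrict (A n ×ˢ A n)).map (Prod.map (l n) (l n))))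
    atTop (𝓝 (∫ p, φ p ∂π))
  almost_isometry : ∀ n, ∀ x ∈ A n, ∀ y ∈ A n,
    dL (l n x) (l n y) ≤ dLn n x y + (2 : ℝ≥0∞)⁻¹ ^ n ∧
    dLn n x y ≤ dL (l n x) (l n y) + (2 : ℝ≥0∞)⁻¹ ^ n
  tendsto : ∀ (u v : ∀ n, Y n) (x y : X), (∀ᶠ n in atTop, u n ∈ A n ∧ v n ∈ A n) →
    Tendsto (fun n => l n (u n)) atTop (𝓝 x) → Tendsto (fun n => l n (v n)) atTop (𝓝 y) →
    Tendsto (fun n => dLn n (u n) (v n)) atTop (𝓝 (dL x y))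

/-- `x` is the limit of a sequence of points of the sets `A n`. -/
def IsLimitPoint [TopologicalSpace X] (A : ∀ n, Set (Y n)) (l : ∀ n, Y n → X) (x : X) : Prop :=
  ∃ u : ∀ n, Y n, (∀ᶠ n in atTop, u n ∈ A n) ∧ Tendsto (fun n => l n (u n)) atTop (𝓝 x)

variable [MetricSpace X] [MeasurableSpace X]
  {dLn : ∀ n, Y n → Y n → ℝ≥0∞} {πn : ∀ n, Measure (Y n × Y n)} {dL : X → X → ℝ≥0∞}
  {π : Measure (X × X)} {A : ∀ n, Set (Y n)} {l : ∀ n, Y n → X}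

namespace ConvergesVia

/-- The convergence of the distances is locally uniform. -/
theorem exists_forall_mem (hc : ConvergesVia dLn πn dL π A l) {x y : X} (hx : IsLimitPoint A l x)
    (hy : IsLimitPoint A l y) {V : Set ℝ≥0∞} (hV : V ∈ 𝓝 (dL x y)) :
    ∃ r > 0, ∃ N : ℕ, ∀ n ≥ N, ∀ u ∈ A n, ∀ v ∈ A n, dist (l n u) x < r → dist (l n v) y < r →
      dLn n u v ∈ V := by
  by_contra! hcon
  obtain ⟨a, haA, ha⟩ := hx
  obtain ⟨b, hbA, hb⟩ := hy
  have hfreq : ∀ k : ℕ, ∃ᶠ n in atTop, ∃ u ∈ A n, ∃ v ∈ A n, dist (l n u) x < 1 / ((k : ℝ) + 1) ∧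
      dist (l n v) y < 1 / ((k : ℝ) + 1) ∧ dLn n u v ∉ V := by
    intro k
    rw [frequently_atTop]
    intro N
    obtain ⟨n, hn, u, hu, v, hv, h1, h2, h3⟩ := hcon (1 / ((k : ℝ) + 1)) Nat.one_div_pos_of_nat N
    exact ⟨n, hn, u, hu, v, hv, h1, h2, h3⟩
  -- The hypothesis concerns full sequences only, so the bad pairs found along `φ` are completed at
  -- the other indices by `a` and `b`, which converge to `x` and `y`.
  obtain ⟨φ, hφ, hbad⟩ := extraction_forall_of_frequently hfreq
  have hsel : ∀ n, ∃ u v : Y n, (n ∉ range φ → u = a n ∧ v = b n) ∧ ∀ k, φ k = n →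
      u ∈ A n ∧ v ∈ A n ∧ dist (l n u) x < 1 / ((k : ℝ) + 1) ∧
      dist (l n v) y < 1 / ((k : ℝ) + 1) ∧ dLn n u v ∉ V := by
    intro n
    by_cases hn : n ∈ range φ
    · obtain ⟨k, rfl⟩ := hn
      obtain ⟨u, hu, v, hv, h⟩ := hbad k
      refine ⟨u, v, fun hn => absurd (mem_range_self k) hn, fun k' hk' => ?_⟩
      rw [hφ.injective hk']
      exact ⟨hu, hv, h⟩
    · exact ⟨a n, b n, fun _ => ⟨rfl, rfl⟩, fun k hk => absurd ⟨k, hk⟩ hn⟩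
  choose u v hdef hsub using hsel
  have hA : ∀ᶠ n in atTop, u n ∈ A n ∧ v n ∈ A n := by
    filter_upwards [haA, hbA] with n h1 h2
    by_cases hn : n ∈ range φ
    · obtain ⟨k, hk⟩ := hn
      exact ⟨(hsub n k hk).1, (hsub n k hk).2.1⟩
    · rw [(hdef n hn).1, (hdef n hn).2]
      exact ⟨h1, h2⟩
  have hsmall : ∀ ε > 0, ∀ᶠ n in atTop, ∀ k, φ k = n → 1 / ((k : ℝ) + 1) < ε := by
    intro ε hε
    obtain ⟨K, hK⟩ := exists_nat_one_div_lt hε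
    filter_upwards [eventually_ge_atTop (φ K)] with n hn k hk
    have hKk : K ≤ k := hφ.le_iff_le.1 (hk ▸ hn)
    refine lt_of_le_of_lt ?_ hK
    gcongr
  have hu : Tendsto (fun n => l n (u n)) atTop (𝓝 x) := by
    rw [Metric.tendsto_nhds] at ha ⊢
    intro ε hε
    filter_upwards [ha ε hε, hsmall ε hε] with n h1 h2
    by_cases hn : n ∈ range φ
    · obtain ⟨k, hk⟩ := hn
      exact (hsub n k hk).2.2.1.trans (h2 k hk)
    · rwa [(hdef n hn).1]
  have hv : Tendsto (fun n => l n (v n)) atTop (𝓝 y) := by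
    rw [Metric.tendsto_nhds] at hb ⊢
    intro ε hε
    filter_upwards [hb ε hε, hsmall ε hε] with n h1 h2
    by_cases hn : n ∈ range φ
    · obtain ⟨k, hk⟩ := hn
      exact (hsub n k hk).2.2.2.1.trans (h2 k hk)
    · rwa [(hdef n hn).2]
  have hlim := hφ.tendsto_atTop.eventually ((hc.tendsto u v x y hA hu hv).eventually_mem hV)
  obtain ⟨k, hk⟩ := hlim.exists
  exact (hsub _ k rfl).2.2.2.2 hk

/-- Convergence of the distances along subsequences. -/
theorem tendsto_comp (hc : ConvergesVia dLn πn dL π A l) {x y : X} (hx : IsLimitPoint A l x)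
    (hy : IsLimitPoint A l y) {ι : Type*} {F : Filter ι} {m : ι → ℕ} (hm : Tendsto m F atTop)
    {u v : ∀ i, Y (m i)} (hu : ∀ᶠ i in F, u i ∈ A (m i)) (hv : ∀ᶠ i in F, v i ∈ A (m i))
    (hux : Tendsto (fun i => l (m i) (u i)) F (𝓝 x))
    (hvy : Tendsto (fun i => l (m i) (v i)) F (𝓝 y)) :
    Tendsto (fun i => dLn (m i) (u i) (v i)) F (𝓝 (dL x y)) := by
  intro V hV
  obtain ⟨r, hr, N, hN⟩ := hc.exists_forall_mem hx hy hV
  rw [mem_map]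
  filter_upwards [hm.eventually_ge_atTop N, hu, hv, Metric.tendsto_nhds.1 hux r hr,
    Metric.tendsto_nhds.1 hvy r hr] with i h1 h2 h3 h4 h5
  exact hN _ h1 _ h2 _ h3 h4 h5

/-- `d_L` is continuous on the set of limit points. -/
theorem continuousOn (hc : ConvergesVia dLn πn dL π A l) :
    ContinuousOn (fun p : X × X => dL p.1 p.2)
      {p | IsLimitPoint A l p.1 ∧ IsLimitPoint A l p.2} := by
  rintro ⟨x, y⟩ ⟨hx, hy⟩ V hV
  -- A closed neighbourhood, since the distance of nearby limit points is a limit of approximating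
  -- distances lying in `V'`.
  obtain ⟨V', hV', hcl, hsub⟩ := exists_mem_nhds_isClosed_subset hV
  obtain ⟨r, hr, N, hN⟩ := hc.exists_forall_mem hx hy hV'
  have hball : Metric.ball (x, y) r ∈ 𝓝[{p | IsLimitPoint A l p.1 ∧ IsLimitPoint A l p.2}] (x, y) :=
    mem_nhdsWithin_of_mem_nhds (Metric.ball_mem_nhds _ hr)
  rw [mem_map]
  filter_upwards [hball, self_mem_nhdsWithin] with ⟨x', y'⟩ hb ⟨⟨u, hu, hux⟩, ⟨v, hv, hvy⟩⟩
  rw [Metric.mem_ball, Prod.dist_eq, max_lt_iff] at hb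
  refine hsub (hcl.mem_of_tendsto (hc.tendsto u v x' y' (hu.and hv) hux hvy) ?_)
  have h1 := hux.eventually (Metric.isOpen_ball.mem_nhds (Metric.mem_ball.2 hb.1))
  have h2 := hvy.eventually (Metric.isOpen_ball.mem_nhds (Metric.mem_ball.2 hb.2))
  filter_upwards [hu, hv, h1, h2, eventually_ge_atTop N] with n g1 g2 g3 g4 g5
  exact hN n g5 _ g1 _ g2 g3 g4

theorem aemeasurable_prodMap (hc : ConvergesVia dLn πn dL π A l) (n : ℕ) :
    AEMeasurable (Prod.map (l n) (l n)) ((πn n).restrict (A n ×ˢ A n)) := by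
  refine aemeasurable_restrict_of_measurable_subtype
    ((hc.measurableSet n).prod (hc.measurableSet n)) ?_
  have h1 : Measurable fun x : ↥(A n ×ˢ A n) => (⟨x.1.1, x.2.1⟩ : A n) :=
    (measurable_fst.comp measurable_subtype_coe).subtype_mk
  have h2 : Measurable fun x : ↥(A n ×ˢ A n) => (⟨x.1.2, x.2.2⟩ : A n) :=
    (measurable_snd.comp measurable_subtype_coe).subtype_mk
  exact ((hc.measurable n).comp h1).prodMk ((hc.measurable n).comp h2)

theorem map_apply (hc : ConvergesVia dLn πn dL π A l) (n : ℕ) {U : Set (X × X)}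
    (hU : MeasurableSet U) :
    ((πn n).restrict (A n ×ˢ A n)).map (Prod.map (l n) (l n)) U =
      πn n (Prod.map (l n) (l n) ⁻¹' U ∩ A n ×ˢ A n) := by
  rw [Measure.map_apply_of_aemeasurable (hc.aemeasurable_prodMap n) hU, Measure.restrict_apply']
  exact (hc.measurableSet n).prod (hc.measurableSet n)

theorem tendsto_mass [IsProbabilityMeasure π] (hc : ConvergesVia dLn πn dL π A l) :
    Tendsto (fun n => (πn n).real (A n ×ˢ A n)) atTop (𝓝 1) := by
  have := hc.weak (BoundedContinuousFunction.const _ 1)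
  simp only [BoundedContinuousFunction.const_apply, integral_const, smul_eq_mul, mul_one,
    probReal_univ] at this
  refine this.congr fun n => ?_
  rw [measureReal_def, measureReal_def, hc.map_apply n MeasurableSet.univ]
  simp

theorem measurableSet_inter_preimage (hc : ConvergesVia dLn πn dL π A l) (n : ℕ) {U : Set X}
    (hU : MeasurableSet U) : MeasurableSet (A n ∩ l n ⁻¹' U) := by
  have := (hc.measurableSet n).subtype_image (hc.measurable n hU)
  convert this using 1
  ext x
  simp [and_comm]

end ConvergesVia

end Convergence

/-! ### Portmanteau inequalities for the restricted plans. -/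

section WeakConvergence

variable {Y : ℕ → Type*} [∀ n, MeasurableSpace (Y n)] {X : Type*} [MetricSpace X]
  [MeasurableSpace X]
  {dLn : ∀ n, Y n → Y n → ℝ≥0∞} {πn : ∀ n, Measure (Y n × Y n)} [∀ n, IsProbabilityMeasure (πn n)]
  {dL : X → X → ℝ≥0∞} {π : Measure (X × X)} [IsProbabilityMeasure π] {A : ∀ n, Set (Y n)}
  {l : ∀ n, Y n → X}

namespace ConvergesVia

theorem eventually_measure_compl_lt (hc : ConvergesVia dLn πn dL π A l) {c : ℝ≥0∞} (h0 : 0 < c) :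
    ∀ᶠ n in atTop, πn n (A n ×ˢ A n)ᶜ < c := by
  have h1 : Tendsto (fun n => (πn n).real (A n ×ˢ A n)ᶜ) atTop (𝓝 0) := by
    have := hc.tendsto_mass.const_sub 1
    rw [sub_self] at this
    refine this.congr fun n => ?_
    rw [probReal_compl_eq_one_sub ((hc.measurableSet n).prod (hc.measurableSet n))]
  have h2 := ENNReal.tendsto_ofReal h1
  rw [ENNReal.ofReal_zero] at h2
  filter_upwards [h2.eventually (gt_mem_nhds h0)] with n hn
  rwa [ofReal_measureReal] at hn

variable [PolishSpace X] [BorelSpace X]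

theorem eventually_lt_of_isClosed (hc : ConvergesVia dLn πn dL π A l) {F : Set (X × X)}
    (hF : IsClosed F) {c : ℝ≥0∞} (hlt : π F < c) :
    ∀ᶠ n in atTop, πn n (Prod.map (l n) (l n) ⁻¹' F ∩ A n ×ˢ A n) < c := by
  let ρ : ℕ → FiniteMeasure (X × X) := fun n =>
    ⟨((πn n).restrict (A n ×ˢ A n)).map (Prod.map (l n) (l n)), inferInstance⟩
  let ρ' : FiniteMeasure (X × X) := ⟨π, inferInstance⟩
  have hlim : Tendsto ρ atTop (𝓝 ρ') :=
    FiniteMeasure.tendsto_iff_forall_integral_tendsto.2 hc.weak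
  have := FiniteMeasure.limsup_measure_closed_le_of_tendsto hlim hF
  filter_upwards [eventually_lt_of_limsup_lt (lt_of_le_of_lt this hlt)] with n hn
  rwa [← hc.map_apply n hF.measurableSet]

/-- The restricted plans are not probabilities. With `c < c' < π U`, the complement of `U`
eventually has mass below `1 - c'` and the part outside `A n ×ˢ A n` mass below `c' - c`; more than
`c` is left. -/
theorem eventually_gt_of_isOpen (hc : ConvergesVia dLn πn dL π A l) {U : Set (X × X)}
    (hU : IsOpen U) {c : ℝ≥0∞} (hlt : c < π U) :
    ∀ᶠ n in atTop, c < πn n (Prod.map (l n) (l n) ⁻¹' U ∩ A n ×ˢ A n) := by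
  obtain ⟨c', hcc', hc'⟩ := exists_between hlt
  have hle : π U ≤ 1 := prob_le_one
  have hc't : c' ≠ ⊤ := (hc'.trans_le (hle.trans le_top)).ne
  have h1 : π Uᶜ < 1 - c' := by
    rw [prob_compl_eq_one_sub hU.measurableSet]
    refine lt_tsub_iff_right.2 ?_
    calc 1 - π U + c' < 1 - π U + π U :=
          ENNReal.add_lt_add_left (ENNReal.sub_ne_top ENNReal.one_ne_top) hc'
      _ = 1 := tsub_add_cancel_of_le hle
  filter_upwards [hc.eventually_lt_of_isClosed hU.isClosed_compl h1,
    hc.eventually_measure_compl_lt (tsub_pos_of_lt hcc')] with n h2 h3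
  by_contra! hcon
  have hstrict : πn n ((Prod.map (l n) (l n) ⁻¹' U ∩ A n ×ˢ A n) ∪
          (Prod.map (l n) (l n) ⁻¹' Uᶜ ∩ A n ×ˢ A n) ∪ (A n ×ˢ A n)ᶜ) < c + (1 - c') + (c' - c) := by
    refine (measure_union_le _ _).trans_lt (ENNReal.add_lt_add_of_le_of_lt ?_ ?_ h3)
    · exact measure_ne_top _ _
    · exact (measure_union_le _ _).trans (add_le_add hcon h2.le)
  have huniv : (Prod.map (l n) (l n) ⁻¹' U ∩ A n ×ˢ A n) ∪
          (Prod.map (l n) (l n) ⁻¹' Uᶜ ∩ A n ×ˢ A n) ∪ (A n ×ˢ A n)ᶜ = univ := by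
    refine eq_univ_of_forall fun p => ?_
    by_cases hp : p ∈ A n ×ˢ A n
    · by_cases hpU : Prod.map (l n) (l n) p ∈ U
      exacts [Or.inl (Or.inl ⟨hpU, hp⟩), Or.inl (Or.inr ⟨hpU, hp⟩)]
    · exact Or.inr hp
  rw [huniv, measure_univ] at hstrict
  have : c + (1 - c') + (c' - c) = 1 := by
    rw [add_right_comm, add_tsub_cancel_of_le hcc'.le, add_tsub_cancel_of_le (hc'.le.trans hle)]
  exact absurd hstrict (by rw [this]; exact lt_irrefl _)

end ConvergesVia

end WeakConvergence

/-! ### Monotonicity and carriers of the limit plan. -/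

section LimitCarrier

variable {Y : ℕ → Type*} [∀ n, MeasurableSpace (Y n)]
  {X : Type*} [MetricSpace X] [PolishSpace X] [MeasurableSpace X] [BorelSpace X]
  {dLn : ∀ n, Y n → Y n → ℝ≥0∞} {πn : ∀ n, Measure (Y n × Y n)} [∀ n, IsProbabilityMeasure (πn n)]
  {dL : X → X → ℝ≥0∞} {π : Measure (X × X)} [IsProbabilityMeasure π] {A : ∀ n, Set (Y n)}
  {l : ∀ n, Y n → X} {Γn : ∀ n, Set (Y n × Y n)} {Γ : Set (X × X)}

namespace ConvergesVia

/-- Every ball around `(w, z)` is eventually charged by the image plans, hence meets the image of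
the full-measure set `Γn n`. -/
theorem exists_seq_of_mem_support (hc : ConvergesVia dLn πn dL π A l)
    (hΓn : ∀ n, πn n (Γn n)ᶜ = 0) {w z : X} (hwz : (w, z) ∈ π.support) :
    ∃ u v : ∀ n, Y n, (∀ᶠ n in atTop, (u n, v n) ∈ Γn n ∧ u n ∈ A n ∧ v n ∈ A n) ∧
      Tendsto (fun n => l n (u n)) atTop (𝓝 w) ∧ Tendsto (fun n => l n (v n)) atTop (𝓝 z) := by
  have (n : ℕ) : Nonempty (Y n × Y n) := (πn n).nonempty_of_neZero
  obtain ⟨u, hu, hlim⟩ := exists_seq_tendsto_of_eventually_exists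
    (L := fun n => Prod.map (l n) (l n)) (Q := fun n => Γn n ∩ A n ×ˢ A n) (x := (w, z)) (by
      intro r hr
      have hpos := Measure.mem_support_iff_forall (w, z) |>.1 hwz _ (Metric.ball_mem_nhds _ hr)
      filter_upwards [hc.eventually_gt_of_isOpen Metric.isOpen_ball hpos] with n hn
      by_contra! hcon
      refine hn.ne' (measure_mono_null (fun q hq => ?_) (hΓn n))
      intro hqΓ
      exact absurd (Metric.mem_ball.1 hq.1) (not_lt.2 (hcon q ⟨hqΓ, hq.2⟩)))
  refine ⟨fun n => (u n).1, fun n => (u n).2, ?_, ?_, ?_⟩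
  · filter_upwards [hu] with n hn
    exact ⟨hn.1, hn.2.1, hn.2.2⟩
  · exact (continuous_fst.tendsto _).comp hlim
  · exact (continuous_snd.tendsto _).comp hlim

theorem isLimitPoint_of_mem_support (hc : ConvergesVia dLn πn dL π A l) {p : X × X}
    (hp : p ∈ π.support) : IsLimitPoint A l p.1 ∧ IsLimitPoint A l p.2 := by
  obtain ⟨u, v, h, hu, hv⟩ := hc.exists_seq_of_mem_support (Γn := fun _ => univ)
    (by simp) (show (p.1, p.2) ∈ π.support from hp)
  exact ⟨⟨u, h.mono fun n hn => hn.2.1, hu⟩, ⟨v, h.mono fun n hn => hn.2.2, hv⟩⟩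

/-- This does not follow from the statement on `π.support`, whose projection need not be closed. -/
theorem isLimitPoint_of_mem_support_fst (hc : ConvergesVia dLn πn dL π A l) {x : X}
    (hx : x ∈ (π.map Prod.fst).support) : IsLimitPoint A l x := by
  have (n : ℕ) : Nonempty (Y n) := (πn n).nonempty_of_neZero.map Prod.fst
  refine exists_seq_tendsto_of_eventually_exists fun r hr => ?_
  have hpos := Measure.mem_support_iff_forall x |>.1 hx _ (Metric.ball_mem_nhds _ hr)
  rw [Measure.map_apply measurable_fst Metric.isOpen_ball.measurableSet] at hpos
  filter_upwards [hc.eventually_gt_of_isOpen (Metric.isOpen_ball.preimage continuous_fst) hpos]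
    with n hn
  obtain ⟨q, hq⟩ := nonempty_of_measure_ne_zero hn.ne'
  exact ⟨q.1, hq.2.1, hq.1⟩

/-- Chains in the support of the limit plan are limits of chains. -/
theorem exists_seq_chainCost (hc : ConvergesVia dLn πn dL π A l)
    (hΓn : ∀ n, πn n (Γn n)ᶜ = 0) (hΓ : Γ ⊆ π.support) {w z : X} {P Q : ℝ≥0∞}
    (h : ChainCost dL Γ w z P Q) :
    IsLimitPoint A l w ∧ IsLimitPoint A l z ∧
    ∃ (u v : ∀ n, Y n) (p q : ℕ → ℝ≥0∞),
      (∀ᶠ n in atTop, ChainCost (dLn n) (Γn n) (u n) (v n) (p n) (q n) ∧ u n ∈ A n ∧ v n ∈ A n) ∧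
      Tendsto (fun n => l n (u n)) atTop (𝓝 w) ∧ Tendsto (fun n => l n (v n)) atTop (𝓝 z) ∧
      Tendsto p atTop (𝓝 P) ∧ Tendsto q atTop (𝓝 Q) := by
  induction h with
  | @single w z hm =>
    obtain ⟨u, v, h, hu, hv⟩ := hc.exists_seq_of_mem_support hΓn (hΓ hm)
    have hl := hc.isLimitPoint_of_mem_support (hΓ hm)
    refine ⟨hl.1, hl.2, u, v, fun n => dLn n (u n) (v n), fun _ => 0, ?_, hu, hv, ?_,
      tendsto_const_nhds⟩
    · exact h.mono fun n hn => ⟨.single hn.1, hn.2⟩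
    · exact hc.tendsto u v w z (h.mono fun n hn => hn.2) hu hv
  | @cons w z w' z' P Q hm _ ih =>
    obtain ⟨hw', hz', u', v', p', q', h', hu', hv', hp', hq'⟩ := ih
    obtain ⟨u, v, h, hu, hv⟩ := hc.exists_seq_of_mem_support hΓn (hΓ hm)
    have hl := hc.isLimitPoint_of_mem_support (hΓ hm)
    refine ⟨hl.1, hz', u, v', fun n => dLn n (u n) (v n) + p' n,
      fun n => dLn n (u' n) (v n) + q' n, ?_, hu, hv', ?_, ?_⟩
    · filter_upwards [h, h'] with n g1 g2
      exact ⟨.cons g1.1 g2.1, g1.2.1, g2.2.2⟩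
    · exact (hc.tendsto u v w z (h.mono fun n hn => hn.2) hu hv).add hp'
    · refine (hc.tendsto u' v w' z ?_ hu' hv).add hq'
      filter_upwards [h, h'] with n g1 g2
      exact ⟨g2.2.1, g1.2.2⟩

theorem isCyclicallyMonotone_of_subset_support (hc : ConvergesVia dLn πn dL π A l)
    (hΓn : ∀ n, πn n (Γn n)ᶜ = 0) (hm : ∀ n, IsCyclicallyMonotone (dLn n) (Γn n))
    (hΓ : Γ ⊆ π.support) : IsCyclicallyMonotone dL Γ := by
  rw [isCyclicallyMonotone_iff]
  intro w z P Q h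
  obtain ⟨-, -, u, v, p, q, h, hu, hv, hp, hq⟩ := hc.exists_seq_chainCost hΓn hΓ h
  refine le_of_tendsto_of_tendsto hp
    (hq.add (hc.tendsto u v w z (h.mono fun n hn => hn.2) hu hv)) ?_
  filter_upwards [h] with n hn
  exact isCyclicallyMonotone_iff.1 (hm n) _ _ _ _ hn.1

/-- Limits of pairs of points in ray order are compatible with the support of the limit plan. -/
theorem isCompatiblePair_of_tendsto [∀ n, MetricSpace (Y n)] (hc : ConvergesVia dLn πn dL π A l)
    (hdLn : ∀ n, IsRaySpace (dLn n))
    (hΓn : ∀ n, πn n (Γn n)ᶜ = 0) (hm : ∀ n, IsCyclicallyMonotone (dLn n) (Γn n))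
    (hf : ∀ n, ∀ p ∈ Γn n, dLn n p.1 p.2 ≠ ⊤) (hΓ : Γ ⊆ π.support) {x y : X}
    (hx : IsLimitPoint A l x) (hy : IsLimitPoint A l y) {m : ℕ → ℕ} (hmt : Tendsto m atTop atTop)
    {a b : ∀ k, Y (m k)} (ha : ∀ k, a k ∈ A (m k)) (hb : ∀ k, b k ∈ A (m k))
    (hG : ∀ k, (a k, b k) ∈ orientedRays (dLn (m k)) (Γn (m k)))
    (hax : Tendsto (fun k => l (m k) (a k)) atTop (𝓝 x))
    (hby : Tendsto (fun k => l (m k) (b k)) atTop (𝓝 y)) : IsCompatiblePair dL Γ x y := by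
  intro w z P Q h
  obtain ⟨hw, hz, u, v, p, q, h, hu, hv, hp, hq⟩ := hc.exists_seq_chainCost hΓn hΓ h
  have h' := hmt.eventually h
  have ha' := Eventually.of_forall (f := atTop) ha
  have hb' := Eventually.of_forall (f := atTop) hb
  refine le_of_tendsto_of_tendsto
    ((hp.comp hmt).add (hc.tendsto_comp hx hy hmt ha' hb' hax hby))
    (((hq.comp hmt).add (hc.tendsto_comp hx hz hmt ha' (h'.mono fun k hk => hk.2.2) hax
      (hv.comp hmt))).add (hc.tendsto_comp hw hy hmt (h'.mono fun k hk => hk.2.1) hb'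
      (hu.comp hmt) hby)) ?_
  filter_upwards [h'] with k hk
  exact isCompatiblePair_of_mem_orientedRays (hdLn _) (hm _) (hf _) (hG k) _ _ _ _ hk.1

theorem measure_eq_top_eq_zero (hc : ConvergesVia dLn πn dL π A l) (hdL : IsRaySpace dL)
    {C : ℝ≥0} (hC : ∀ n, ∫⁻ p, dLn n p.1 p.2 ∂(πn n) ≤ C)
    (hmeas : ∀ n, Measurable fun p : Y n × Y n => dLn n p.1 p.2) :
    π {p | dL p.1 p.2 = ⊤} = 0 := by
  have key : ∀ M : ℕ, π {p | dL p.1 p.2 = ⊤} ≤ C / (M + 1 : ℕ) := by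
    intro M
    by_contra! hlt
    -- The additional `1` absorbs the error `2⁻ⁿ`, so that Markov's inequality applies to `dLn n` at
    -- level `M + 1`.
    have hU : IsOpen {p : X × X | ((M + 1 : ℕ) + 1 : ℝ≥0∞) < dL p.1 p.2} :=
      hdL.lowerSemicontinuous.isOpen_preimage _
    have hlt' := hlt.trans_le (measure_mono (t := {p : X × X | ((M + 1 : ℕ) + 1 : ℝ≥0∞) <
      dL p.1 p.2}) fun p (hp : dL p.1 p.2 = ⊤) => by
        show _ < dL p.1 p.2
        rw [hp]
        exact ENNReal.add_lt_top.2 ⟨ENNReal.natCast_lt_top _, ENNReal.one_lt_top⟩)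
    obtain ⟨n, hn⟩ := (hc.eventually_gt_of_isOpen hU hlt').exists
    refine absurd hn (not_lt.2 ?_)
    have hM0 : ((M + 1 : ℕ) : ℝ≥0∞) ≠ 0 := by simp
    refine le_trans (measure_mono (t := {p | ((M + 1 : ℕ) : ℝ≥0∞) ≤ dLn n p.1 p.2}) ?_) ?_
    · rintro p ⟨hp, hpA⟩
      have h1 := (hc.almost_isometry n p.1 hpA.1 p.2 hpA.2).1
      have h2 : (2 : ℝ≥0∞)⁻¹ ^ n ≤ 1 := pow_le_one₀ zero_le (by simp)
      have h3 := (lt_of_lt_of_le hp h1).le.trans (add_le_add_right h2 _)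
      exact (ENNReal.add_le_add_iff_right ENNReal.one_ne_top).1 h3
    · rw [ENNReal.le_div_iff_mul_le (Or.inl hM0) (Or.inl (ENNReal.natCast_ne_top _)), mul_comm]
      exact (mul_meas_ge_le_lintegral (hmeas n) _).trans (hC n)
  have hlim : Tendsto (fun M : ℕ => (C : ℝ≥0∞) / (M + 1 : ℕ)) atTop (𝓝 0) :=
    (ENNReal.Tendsto.const_div (tendsto_add_atTop_iff_nat 1 |>.2 ENNReal.tendsto_nat_nhds_top)
      (Or.inr ENNReal.coe_ne_top)).trans (by simp)
  exact le_antisymm (ge_of_tendsto' hlim key) zero_le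

/-- The limit plan has a monotone carrier inside its support. -/
theorem exists_isMonotoneCarrier (hc : ConvergesVia dLn πn dL π A l) (hdL : IsRaySpace dL)
    (hΓn : ∀ n, πn n (Γn n)ᶜ = 0) (hm : ∀ n, IsCyclicallyMonotone (dLn n) (Γn n))
    {C : ℝ≥0} (hC : ∀ n, ∫⁻ p, dLn n p.1 p.2 ∂(πn n) ≤ C)
    (hmeas : ∀ n, Measurable fun p : Y n × Y n => dLn n p.1 p.2) :
    ∃ Γ ⊆ π.support, IsMonotoneCarrier dL π Γ := by
  set D : Set (X × X) := π.support ∩ {p | dL p.1 p.2 ≠ ⊤} with hD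
  have hDm : MeasurableSet D := Measure.isClosed_support.measurableSet.inter
    (hdL.lowerSemicontinuous.measurable (measurableSet_singleton ⊤).compl)
  have hD1 : π Dᶜ = 0 := by
    rw [hD, compl_inter]
    refine measure_union_null Measure.measure_compl_support ?_
    rw [compl_ofPred]
    simpa using hc.measure_eq_top_eq_zero hdL hC hmeas
  -- Inner regularity is the only choice involved: any subset of the support is cyclically monotone,
  -- and `d_L` is continuous on it.
  have hKex : ∀ k : ℕ, ∃ K ⊆ D, IsCompact K ∧ π Kᶜ ≤ ((k : ℝ≥0∞) + 1)⁻¹ := by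
    intro k
    obtain ⟨K, hKD, hK, hlt⟩ := hDm.exists_isCompact_sdiff_lt (μ := π) (measure_ne_top _ _)
      (ε := ((k : ℝ≥0∞) + 1)⁻¹) (by simp)
    refine ⟨K, hKD, hK, le_trans (measure_mono (t := D \ K ∪ Dᶜ) fun p hp => ?_)
      ((measure_union_le _ _).trans ?_)⟩
    · by_cases hpD : p ∈ D
      exacts [Or.inl ⟨hpD, hp⟩, Or.inr hpD]
    · rw [hD1, add_zero]; exact hlt.le
  choose K hKD hK hle using hKex
  have hUD : (⋃ k, K k) ⊆ D := iUnion_subset hKD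
  have hacc : ∀ k, accumulate K k ⊆ D := fun k => iUnion₂_subset fun i _ => hKD i
  refine ⟨⋃ k, K k, hUD.trans inter_subset_left, ?_, fun p hp => (hUD hp).2, ?_, ?_⟩
  · exact hc.isCyclicallyMonotone_of_subset_support hΓn hm (hUD.trans inter_subset_left)
  · refine ⟨accumulate K, monotone_accumulate, fun k => isCompact_accumulate hK k, fun k => ?_,
      iUnion_accumulate.symm⟩
    exact hc.continuousOn.mono fun p hp => hc.isLimitPoint_of_mem_support (hacc k hp).1
  · refine le_antisymm (ENNReal.le_of_forall_pos_le_add fun ε hε _ => ?_) zero_le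
    obtain ⟨k, hk⟩ := ENNReal.exists_inv_nat_lt (a := ε) (by simpa using hε.ne')
    rw [zero_add]
    refine (measure_mono (compl_subset_compl.2 (subset_iUnion K k))).trans ((hle k).trans ?_)
    exact (ENNReal.inv_le_inv.2 le_self_add).trans hk.le

theorem eventually_fst_gt_of_isOpen (hc : ConvergesVia dLn πn dL π A l) {U : Set X}
    (hU : IsOpen U) {c : ℝ≥0∞} (hlt : c < π.map Prod.fst U) :
    ∀ᶠ n in atTop, c < (πn n).map Prod.fst (A n ∩ l n ⁻¹' U) := by
  rw [Measure.map_apply measurable_fst hU.measurableSet] at hlt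
  filter_upwards [hc.eventually_gt_of_isOpen (hU.preimage continuous_fst) hlt] with n hn
  rw [Measure.map_apply measurable_fst (hc.measurableSet_inter_preimage n hU.measurableSet)]
  exact hn.trans_le (measure_mono fun p hp => ⟨hp.2.1, hp.1⟩)

/-- The restricted plan misses pairs with first point in `A n` and second point outside; their mass
is eventually below the gap `c - c'`. -/
theorem eventually_fst_lt_of_isClosed (hc : ConvergesVia dLn πn dL π A l) {F : Set X}
    (hF : IsClosed F) {c : ℝ≥0∞} (hlt : π.map Prod.fst F < c) :
    ∀ᶠ n in atTop, (πn n).map Prod.fst (A n ∩ l n ⁻¹' F) < c := by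
  rw [Measure.map_apply measurable_fst hF.measurableSet] at hlt
  obtain ⟨c', h1, h2⟩ := exists_between hlt
  filter_upwards [hc.eventually_lt_of_isClosed (hF.preimage continuous_fst) h1,
    hc.eventually_measure_compl_lt (tsub_pos_of_lt h2)] with n g1 g2
  rw [Measure.map_apply measurable_fst (hc.measurableSet_inter_preimage n hF.measurableSet)]
  calc _ ≤ πn n ((Prod.map (l n) (l n) ⁻¹' (Prod.fst ⁻¹' F) ∩ A n ×ˢ A n) ∪ (A n ×ˢ A n)ᶜ) := by
        refine measure_mono fun p hp => ?_
        by_cases hpA : p ∈ A n ×ˢ A n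
        exacts [Or.inl ⟨hp.2, hpA⟩, Or.inr hpA]
    _ ≤ _ := measure_union_le _ _
    _ < c' + (c - c') := ENNReal.add_lt_add g1 g2
    _ = c := add_tsub_cancel_of_le h2.le

end ConvergesVia

end LimitCarrier

/-! ### Recognizing rays of the limit by compatibility and nonbranching. -/

section LimitRays

variable {X : Type*} [MetricSpace X] {dL : X → X → ℝ≥0∞} {Γ : Set (X × X)}

/-- Compatibility of `(p, x)` with the pair of `Γ'` around `(x, z)` shows that `z`, like `y`,
prolongs the segment from `p` to `x`. By nonbranching the nearer point `y` lies between `x` and `z`.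
-/
theorem mem_orientedRays_of_forward (h : IsRaySpace dL) (hf : ∀ p ∈ Γ, dL p.1 p.2 ≠ ⊤)
    {p x y z : X} (hpx : p ≠ x) (hpx' : dL p x ≠ ⊤) (hxy : dL x y ≠ ⊤)
    (hcomp : IsCompatiblePair dL Γ p x)
    (hadd : (dL p x).toReal + (dL x y).toReal ≤ (dL p y).toReal)
    (hxz : (x, z) ∈ orientedRays dL Γ) (hle : (dL x y).toReal ≤ (dL x z).toReal) :
    (x, y) ∈ orientedRays dL Γ := by
  obtain ⟨w, v, hw, g1, g2, g3, hwv⟩ := (mem_orientedRays_iff h hf).1 hxz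
  have hwvt := ne_top_of_mem_cycleSet hf hw
  have hex := hcomp.le_of_mem_cycleSet hf hw
  have fpz := h.ne_top_trans hpx' g2
  have fpv := h.ne_top_trans fpz g3
  have hexr := ENNReal.toReal_mono (ENNReal.add_ne_top.2 ⟨fpv, g1⟩) hex
  rw [ENNReal.toReal_add hwvt hpx', ENNReal.toReal_add fpv g1] at hexr
  have t1 := h.toReal_triangle fpz g3
  have hyz := h.ne_top_trans (h.ne_top_symm hxy) g2
  have := h.add_le_of_prolongations hpx hpx' hxy g2 hadd (by linarith) hle
  exact mem_orientedRays_of_between h hf hxz (by simp [h.self]) hxy hyz (by simpa [h.self] using this)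

/-- The mirror image of `mem_orientedRays_of_forward`, with `q` beyond `y` in the role of `p`. -/
theorem mem_orientedRays_of_backward (h : IsRaySpace dL) (hf : ∀ p ∈ Γ, dL p.1 p.2 ≠ ⊤)
    {w x y q : X} (hyq : y ≠ q) (hyq' : dL y q ≠ ⊤) (hxy : dL x y ≠ ⊤)
    (hcomp : IsCompatiblePair dL Γ y q)
    (hadd : (dL x y).toReal + (dL y q).toReal ≤ (dL x q).toReal)
    (hwy : (w, y) ∈ orientedRays dL Γ) (hle : (dL x y).toReal ≤ (dL w y).toReal) :
    (x, y) ∈ orientedRays dL Γ := by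
  obtain ⟨a, v, ha, g1, g2, g3, hav⟩ := (mem_orientedRays_iff h hf).1 hwy
  have havt := ne_top_of_mem_cycleSet hf ha
  have hex := hcomp.le_of_mem_cycleSet hf ha
  have fwq := h.ne_top_trans g2 hyq'
  have faq := h.ne_top_trans g1 fwq
  have hexr := ENNReal.toReal_mono (ENNReal.add_ne_top.2 ⟨g3, faq⟩) hex
  rw [ENNReal.toReal_add havt hyq', ENNReal.toReal_add g3 faq] at hexr
  have t1 := h.toReal_triangle g1 fwq
  have hwx := h.ne_top_trans g2 (h.ne_top_symm hxy)
  have := h.add_le_of_prolongations (p := q) (x := y) (a := x) (b := w) hyq.symm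
    (h.ne_top_symm hyq') (h.ne_top_symm hxy) (h.ne_top_symm g2)
    (by rw [h.symm q y, h.symm y x, h.symm q x]; linarith)
    (by rw [h.symm q y, h.symm y w, h.symm q w]; linarith)
    (by rwa [h.symm y x, h.symm y w])
  rw [h.symm y x, h.symm y w, h.symm x w] at this
  refine mem_orientedRays_of_between h hf hwy hwx hxy (by simp [h.self]) ?_
  simp only [h.self, ENNReal.toReal_zero, add_zero]
  linarith

end LimitRays

/-! ### The uniform estimate on inner distances. -/

section Sequence

variable {Y : ℕ → Type*} [∀ n, MetricSpace (Y n)] [∀ n, PolishSpace (Y n)]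
  [∀ n, MeasurableSpace (Y n)] [∀ n, BorelSpace (Y n)]
  {dLn : ∀ n, Y n → Y n → ℝ≥0∞} {πn : ∀ n, Measure (Y n × Y n)} [∀ n, IsProbabilityMeasure (πn n)]
  {Γn : ∀ n, Set (Y n × Y n)} {fn : ∀ n, Y n → Y n}

/-- Uniformly in `n`, up to small measure the points of a bounded set have many inner distances. -/
theorem exists_forall_measure_le_add (hdLn : ∀ n, IsRaySpace (dLn n))
    (hsing : ∀ n, (πn n).map Prod.fst ⟂ₘ (πn n).map Prod.snd)
    (hΓn : ∀ n, IsMonotoneCarrier (dLn n) (πn n) (Γn n))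
    (hfn : ∀ n, IsCrossSection (dLn n) (Γn n) (fn n))
    (hfn_meas : ∀ n, AEMeasurable (fn n)
      (((πn n).map Prod.fst).restrict (transportSet (dLn n) (Γn n))))
    (habs : ∀ n, AbsContAlongRays (dLn n) (Γn n) (fn n) ((πn n).map Prod.fst))
    (hequi : EquiIntegrableRayDensities dLn Γn fn (fun n => (πn n).map Prod.fst))
    {ε : ℝ≥0} (hε : 0 < ε) : ∃ η : ℝ, 0 < η ∧ ∀ n, ∀ S : Set (Y n), MeasurableSet S →
      (∃ M : ℝ, ∀ u ∈ S, ∀ v ∈ S, (dLn n u v).toReal ≤ M) →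
      (πn n).map Prod.fst S ≤ (πn n).map Prod.fst {v | v ∈ S ∧
        ENNReal.ofReal η < volume (innerDistances (dLn n) (Γn n) S η v)} + ε := by
  obtain ⟨δ, hδ, hδn⟩ := hequi ε hε
  have hη : (0 : ℝ) < δ / 10 := by positivity
  -- Slices with few inner distances have length at most `5η = δ / 2 < δ`.
  refine ⟨δ / 10, hη, fun n S hS ⟨M, hM⟩ => ?_⟩
  have : IsProbabilityMeasure ((πn n).map Prod.fst) :=
    Measure.isProbabilityMeasure_map measurable_fst.aemeasurable
  set μ := (πn n).map Prod.fst with hμ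
  set F := {v | v ∈ S ∧ ENNReal.ofReal (δ / 10) <
    volume (innerDistances (dLn n) (Γn n) S (δ / 10) v)} with hF
  have hT : ∀ᵐ x ∂μ, x ∈ transportSet (dLn n) (Γn n) :=
    ae_mem_transportSet (hdLn n) (hΓn n).monotone (hΓn n).finite (hΓn n).measurableSet (hfn n)
      (habs n) (ae_exists_moved (measure_diagonal_eq_zero (hsing n)) (hΓn n))
  -- The measurability of `F` is not established; removing its measurable hull leaves a Borel set
  -- and costs no more measure.
  have hlt : μ (S \ toMeasurable μ F) < ε := by
    refine measure_lt_of_slices_le (hdLn n) (hΓn n).monotone (hΓn n).finite (hΓn n).measurableSet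
      (hfn n) (habs n) hT (hfn_meas n) (fun A => hδn n A) (κ := ENNReal.ofReal (5 * (δ / 10)))
      ?_ (hS.diff (measurableSet_toMeasurable _ _)) fun y => ?_
    · rw [← ENNReal.ofReal_coe_nnreal, ENNReal.ofReal_lt_ofReal_iff (by exact_mod_cast hδ)]
      have : (0 : ℝ) < δ := by exact_mod_cast hδ
      linarith
    · refine volume_slice_le (hdLn n) (hΓn n).monotone (hΓn n).finite (hfn n) sdiff_subset hη hM
        (fun v hv => ?_) y
      by_contra! hcon
      exact hv.2 (subset_toMeasurable μ F ⟨hv.1, hcon⟩)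
  calc μ S ≤ μ (toMeasurable μ F ∪ S \ toMeasurable μ F) := measure_mono fun v hv => by
        by_cases hvF : v ∈ toMeasurable μ F
        exacts [Or.inl hvF, Or.inr ⟨hv, hvF⟩]
    _ ≤ μ (toMeasurable μ F) + μ (S \ toMeasurable μ F) := measure_union_le _ _
    _ ≤ μ F + ε := by rw [measure_toMeasurable]; gcongr

end Sequence

/-! ### Upper limits of sets. -/

section LimitSets

/-- The upper limit of a sequence of sets. -/
def upperLimit {W : Type*} [TopologicalSpace W] (D : ℕ → Set W) : Set W :=
  ⋂ m, closure (⋃ k ≥ m, D k)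

theorem isClosed_upperLimit {W : Type*} [TopologicalSpace W] (D : ℕ → Set W) :
    IsClosed (upperLimit D) := isClosed_iInter fun _ => isClosed_closure

theorem le_measure_upperLimit {W : Type*} [TopologicalSpace W] [MeasurableSpace W] [BorelSpace W]
    {μ : Measure W} {D : ℕ → Set W} {c : ℝ≥0∞}
    (hc : ∀ m, c ≤ μ (closure (⋃ k ≥ m, D k))) (hfin : μ (closure (⋃ k ≥ 0, D k)) ≠ ⊤) :
    c ≤ μ (upperLimit D) := by
  have hanti : Antitone fun m => closure (⋃ k ≥ m, D k) := fun m m' h =>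
    closure_mono (iUnion₂_subset fun k hk => subset_iUnion₂_of_subset k (h.trans hk) subset_rfl)
  rw [upperLimit, hanti.measure_iInter (fun m => isClosed_closure.measurableSet.nullMeasurableSet)
    ⟨0, hfin⟩]
  exact le_iInf hc

theorem exists_seq_of_mem_upperLimit {W : Type*} [PseudoMetricSpace W] {D : ℕ → Set W} {x : W}
    (hx : x ∈ upperLimit D) : ∃ (j : ℕ → ℕ) (u : ℕ → W), (∀ k, k ≤ j k) ∧ (∀ k, u k ∈ D (j k)) ∧
      ∀ k : ℕ, dist (u k) x < 1 / ((k : ℝ) + 1) := by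
  have : ∀ k : ℕ, ∃ j, k ≤ j ∧ ∃ u ∈ D j, dist u x < 1 / ((k : ℝ) + 1) := by
    intro k
    obtain ⟨u, hu, hd⟩ := Metric.mem_closure_iff.1 (mem_iInter.1 hx k) _
      (Nat.one_div_pos_of_nat (α := ℝ) (n := k))
    obtain ⟨j, hj, hu⟩ := mem_iUnion₂.1 hu
    exact ⟨j, hj, u, hu, by rwa [dist_comm]⟩
  choose j hj u hu hd using this
  exact ⟨j, u, hj, hu, hd⟩

theorem tendsto_of_dist_lt {W : Type*} [PseudoMetricSpace W] {u : ℕ → W} {x : W}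
    (h : ∀ k : ℕ, dist (u k) x < 1 / ((k : ℝ) + 1)) : Tendsto u atTop (𝓝 x) :=
  tendsto_iff_dist_tendsto_zero.2 (squeeze_zero (fun _ => dist_nonneg) (fun k => (h k).le)
    tendsto_one_div_add_atTop_nhds_zero_nat)

theorem exists_mem_upperLimit {W : Type*} [PseudoMetricSpace W] {D : ℕ → Set W} {x : W}
    {j : ℕ → ℕ} {u : ℕ → W} (hj : Tendsto j atTop atTop) (hu : ∀ k, u k ∈ D (j k))
    (hx : Tendsto u atTop (𝓝 x)) : x ∈ upperLimit D := by
  refine mem_iInter.2 fun m => mem_closure_of_tendsto hx ?_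
  filter_upwards [hj.eventually_ge_atTop m] with k hk
  exact mem_iUnion₂.2 ⟨j k, hk, hu k⟩

end LimitSets

/-! ### Limits of points on approximating rays. -/

section Limit

variable {Y : ℕ → Type*} [∀ n, MetricSpace (Y n)] [∀ n, MeasurableSpace (Y n)]
  {X : Type*} [MetricSpace X] [PolishSpace X] [MeasurableSpace X] [BorelSpace X]
  {dLn : ∀ n, Y n → Y n → ℝ≥0∞} {πn : ∀ n, Measure (Y n × Y n)} [∀ n, IsProbabilityMeasure (πn n)]
  {dL : X → X → ℝ≥0∞} {π : Measure (X × X)} [IsProbabilityMeasure π] {A : ∀ n, Set (Y n)}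
  {l : ∀ n, Y n → X} {Γn : ∀ n, Set (Y n × Y n)} {Γ : Set (X × X)}

/-- Limits of the points of a ray, with inner distances bounded from below, lie on a ray of the
limit structure if the latter is locally long enough. -/
theorem ConvergesVia.exists_mem_orientedRays (hc : ConvergesVia dLn πn dL π A l)
    (hdLn : ∀ n, IsRaySpace (dLn n)) (hdL : IsRaySpace dL)
    (hΓn : ∀ n, IsMonotoneCarrier (dLn n) (πn n) (Γn n))
    (hΓs : Γ ⊆ π.support) (hf : ∀ p ∈ Γ, dL p.1 p.2 ≠ ⊤) {ρ : ℝ} (hρ : 0 < ρ) {η : ℝ} (hη : 0 < η)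
    {K : Set X} (hK : IsCompact K) (hKl : ∀ x ∈ K, IsLimitPoint A l x)
    (hlong : (∀ x ∈ K, ∃ z, (x, z) ∈ orientedRays dL Γ ∧ ρ ≤ (dL x z).toReal) ∨
      (∀ x ∈ K, ∃ w, (w, x) ∈ orientedRays dL Γ ∧ ρ ≤ (dL w x).toReal))
    {m : ℕ → ℕ} (hm : Tendsto m atTop atTop) {S : ∀ k, Set (Y (m k))} (hSA : ∀ k, S k ⊆ A (m k))
    {θ : ℕ → ℝ} (hθ : Tendsto θ atTop (𝓝 0))
    (hSK : ∀ k, ∀ u ∈ S k, ∃ x ∈ K, dist (l (m k) u) x < θ k)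
    (hSρ : ∀ k, ∀ u ∈ S k, ∀ v ∈ S k, dLn (m k) u v ≤ ENNReal.ofReal ρ)
    {v : ∀ k, Y (m k)} (hv : ∀ k, v k ∈ S k) {t' : ℕ → ℝ}
    (ht' : ∀ k, t' k ∈ innerDistances (dLn (m k)) (Γn (m k)) (S k) η (v k)) {y : X} {t : ℝ}
    (hvy : Tendsto (fun k => l (m k) (v k)) atTop (𝓝 y)) (htt : Tendsto t' atTop (𝓝 t)) :
    ∃ x ∈ K, (x, y) ∈ orientedRays dL Γ ∧ (dL x y).toReal = t := by
  choose p hp x hx q hq hpx hxv hvq htx hηp hηq using ht'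
  choose p' hp' hpd using fun k => hSK k _ (hp k)
  choose x' hx' hxd using fun k => hSK k _ (hx k)
  choose q' hq' hqd using fun k => hSK k _ (hq k)
  choose v' hv' hvd using fun k => hSK k _ (hv k)
  -- The sets `S k` shrink onto the compact `K`, so all four points converge along a subsequence,
  -- with limits in `K`.
  obtain ⟨⟨P, x₀, Q, y₀⟩, ⟨hPK, hxK, hQK, hyK⟩, φ, hφ, hlim⟩ :=
    (hK.prod (hK.prod (hK.prod hK))).tendsto_subseq (x := fun k => (p' k, x' k, q' k, v' k))
      fun k => ⟨hp' k, hx' k, hq' k, hv' k⟩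
  have hφt := hφ.tendsto_atTop
  have hmφ := hm.comp hφt
  have transfer : ∀ {a : ∀ k, Y (m k)} {a' : ℕ → X} {b : X},
      (∀ k, dist (l (m k) (a k)) (a' k) < θ k) → Tendsto (a' ∘ φ) atTop (𝓝 b) →
      Tendsto (fun k => l (m (φ k)) (a (φ k))) atTop (𝓝 b) := by
    intro a a' b hd hb
    refine hb.congr_dist (squeeze_zero (fun _ => dist_nonneg) (fun k => ?_) (hθ.comp hφt))
    rw [dist_comm]
    exact (hd (φ k)).le
  have hP := transfer hpd ((continuous_fst.tendsto _).comp hlim)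
  have hX := transfer hxd ((continuous_fst.comp continuous_snd).tendsto _ |>.comp hlim)
  have hQ := transfer hqd
    ((continuous_fst.comp (continuous_snd.comp continuous_snd)).tendsto _ |>.comp hlim)
  have hV := transfer hvd
    ((continuous_snd.comp (continuous_snd.comp continuous_snd)).tendsto _ |>.comp hlim)
  have hyy : y = y₀ := tendsto_nhds_unique (hvy.comp hφt) hV
  subst hyy
  have lP := hKl P hPK
  have lX := hKl x₀ hxK
  have lQ := hKl Q hQK
  have lV := hKl y hyK
  have hd : ∀ {a b : ∀ k, Y (m k)} {a₀ b₀ : X}, (∀ k, a k ∈ S k) → (∀ k, b k ∈ S k) →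
      IsLimitPoint A l a₀ → IsLimitPoint A l b₀ →
      Tendsto (fun k => l (m (φ k)) (a (φ k))) atTop (𝓝 a₀) →
      Tendsto (fun k => l (m (φ k)) (b (φ k))) atTop (𝓝 b₀) →
      dL a₀ b₀ ≤ ENNReal.ofReal ρ ∧
        Tendsto (fun k => (dLn (m (φ k)) (a (φ k)) (b (φ k))).toReal) atTop
          (𝓝 (dL a₀ b₀).toReal) := by
    intro a b a₀ b₀ ha hb la lb hta htb
    have h1 := hc.tendsto_comp la lb hmφ (u := fun k => a (φ k)) (v := fun k => b (φ k))
      (.of_forall fun k => hSA _ (ha _)) (.of_forall fun k => hSA _ (hb _)) hta htb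
    have h2 : dL a₀ b₀ ≤ ENNReal.ofReal ρ :=
      le_of_tendsto' h1 fun k => hSρ _ _ (ha _) _ (hb _)
    exact ⟨h2, (ENNReal.tendsto_toReal (ne_top_of_le_ne_top ENNReal.ofReal_ne_top h2)).comp h1⟩
  have dPX := hd hp hx lP lX hP hX
  have dXV := hd hx hv lX lV hX hV
  have dPV := hd hp hv lP lV hP hV
  have dVQ := hd hv hq lV lQ hV hQ
  have dXQ := hd hx hq lX lQ hX hQ
  have fin : ∀ {a b : X}, dL a b ≤ ENNReal.ofReal ρ → dL a b ≠ ⊤ := fun h =>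
    ne_top_of_le_ne_top ENNReal.ofReal_ne_top h
  have ηP : η ≤ (dL P x₀).toReal := ge_of_tendsto' dPX.2 fun k => hηp _
  have ηQ : η ≤ (dL y Q).toReal := ge_of_tendsto' dVQ.2 fun k => hηq _
  have hne : ∀ {a b : X}, η ≤ (dL a b).toReal → a ≠ b := by
    rintro a _ h rfl
    rw [hdL.self, ENNReal.toReal_zero] at h
    linarith
  have hcm := fun n => (hΓn n).monotone
  have hfi := fun n => (hΓn n).finite
  have addP : (dL P x₀).toReal + (dL x₀ y).toReal ≤ (dL P y).toReal :=
    le_of_tendsto_of_tendsto' (dPX.2.add dXV.2) dPV.2 fun k =>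
      (orientedRays_trans (hdLn _) (hcm _) (hfi _) (hpx _) (hxv _)).2.ge
  have addQ : (dL x₀ y).toReal + (dL y Q).toReal ≤ (dL x₀ Q).toReal :=
    le_of_tendsto_of_tendsto' (dXV.2.add dVQ.2) dXQ.2 fun k =>
      (orientedRays_trans (hdLn _) (hcm _) (hfi _) (hxv _) (hvq _)).2.ge
  have hρxy : (dL x₀ y).toReal ≤ ρ := by
    have := ENNReal.toReal_mono ENNReal.ofReal_ne_top dXV.1
    rwa [ENNReal.toReal_ofReal hρ.le] at this
  refine ⟨x₀, hxK, ?_, tendsto_nhds_unique (dXV.2.congr fun k => htx _) (htt.comp hφt)⟩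
  rcases hlong with hlong | hlong
  · obtain ⟨z, hz, hzρ⟩ := hlong x₀ hxK
    have hcomp : IsCompatiblePair dL Γ P x₀ :=
      hc.isCompatiblePair_of_tendsto hdLn (fun n => (hΓn n).concentrated) hcm hfi hΓs lP lX hmφ
        (a := fun k => p (φ k)) (b := fun k => x (φ k)) (fun k => hSA _ (hp _))
        (fun k => hSA _ (hx _)) (fun k => hpx _) hP hX
    exact mem_orientedRays_of_forward hdL hf (hne ηP) (fin dPX.1) (fin dXV.1) hcomp addP hz
      (hρxy.trans hzρ)
  -- Here the long ray is the one ending at `y`, which also belongs to `K`; hence the margin after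
  -- `y` is used.
  · obtain ⟨w, hw, hwρ⟩ := hlong y hyK
    have hcomp : IsCompatiblePair dL Γ y Q :=
      hc.isCompatiblePair_of_tendsto hdLn (fun n => (hΓn n).concentrated) hcm hfi hΓs lV lQ hmφ
        (a := fun k => v (φ k)) (b := fun k => q (φ k)) (fun k => hSA _ (hv _))
        (fun k => hSA _ (hq _)) (fun k => hvq _) hV hQ
    exact mem_orientedRays_of_backward hdL hf (hne ηQ) (fin dVQ.1) (fin dXV.1) hcomp addQ hw
      (hρxy.trans hwρ)

end Limit

/-! ### Positivity of the translates in the limit. -/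

section Main

variable {Y : ℕ → Type*} [∀ n, MetricSpace (Y n)] [∀ n, MeasurableSpace (Y n)]
  {X : Type*} [MetricSpace X] [PolishSpace X] [MeasurableSpace X] [BorelSpace X]
  {dLn : ∀ n, Y n → Y n → ℝ≥0∞} {πn : ∀ n, Measure (Y n × Y n)} [∀ n, IsProbabilityMeasure (πn n)]
  {dL : X → X → ℝ≥0∞} {π : Measure (X × X)} [IsProbabilityMeasure π] {A : ∀ n, Set (Y n)}
  {l : ∀ n, Y n → X} {Γn : ∀ n, Set (Y n × Y n)} {Γ : Set (X × X)}

/-- The translates of a small compact set of positive measure, along the rays of which it is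
contained in the interior on one side, have positive measure for a set of times of positive
length. -/
theorem ConvergesVia.lintegral_pos_of_isCompact (hc : ConvergesVia dLn πn dL π A l)
    (hdLn : ∀ n, IsRaySpace (dLn n)) (hdL : IsRaySpace dL)
    (hΓn : ∀ n, IsMonotoneCarrier (dLn n) (πn n) (Γn n))
    (hinner : ∀ ε : ℝ≥0, 0 < ε → ∃ η : ℝ, 0 < η ∧ ∀ n, ∀ S : Set (Y n), MeasurableSet S →
      (∃ M : ℝ, ∀ u ∈ S, ∀ v ∈ S, (dLn n u v).toReal ≤ M) →
      (πn n).map Prod.fst S ≤ (πn n).map Prod.fst {v | v ∈ S ∧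
        ENNReal.ofReal η < volume (innerDistances (dLn n) (Γn n) S η v)} + ε)
    (hΓs : Γ ⊆ π.support) (hf : ∀ p ∈ Γ, dL p.1 p.2 ≠ ⊤) {ρ : ℝ} (hρ : 0 < ρ)
    {K : Set X} (hK : IsCompact K) (hKl : ∀ x ∈ K, IsLimitPoint A l x)
    (hKpos : 0 < π.map Prod.fst K)
    (hlong : (∀ x ∈ K, ∃ z, (x, z) ∈ orientedRays dL Γ ∧ ρ ≤ (dL x z).toReal) ∨
      (∀ x ∈ K, ∃ w, (w, x) ∈ orientedRays dL Γ ∧ ρ ≤ (dL w x).toReal))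
    {x₀ : X} {r : ℝ} (hr : 0 < r) {N : ℕ} (hN : ∀ n ≥ N, ∀ u ∈ A n, ∀ v ∈ A n,
      dist (l n u) x₀ < r → dist (l n v) x₀ < r → dLn n u v ≤ ENNReal.ofReal ρ)
    (hKr : K ⊆ Metric.closedBall x₀ (r / 2)) :
    0 < ∫⁻ t in Ioi (0 : ℝ), π.map Prod.fst
      {y | ∃ x ∈ K, (x, y) ∈ orientedRays dL Γ ∧ (dL x y).toReal = t} := by
  set μ := π.map Prod.fst with hμ
  have : IsProbabilityMeasure μ := Measure.isProbabilityMeasure_map measurable_fst.aemeasurable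
  -- With `2c < μ K`, the sets `S k` have mass above `2c`, and an exceptional part of mass `c`
  -- leaves at least `c` for `F k`.
  obtain ⟨c, hc0, hcK⟩ := ENNReal.lt_iff_exists_nnreal_btwn.1 (ENNReal.half_pos hKpos.ne')
  have hc0' : 0 < c := by exact_mod_cast hc0
  have hcc : (c : ℝ≥0∞) + c < μ K := by
    rw [← ENNReal.add_halves (μ K)]
    exact ENNReal.add_lt_add hcK hcK
  obtain ⟨η, hη, hηS⟩ := hinner c hc0'
  -- At most `r / 2`, so that the `θ k`-thickening of `K` stays in the ball of radius `r` where `hN`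
  -- bounds distances by `ρ`.
  set θ : ℕ → ℝ := fun k => r / 2 * (1 / ((k : ℝ) + 1)) with hθdef
  have hθ0 : ∀ k, 0 < θ k := fun k => mul_pos (by linarith) Nat.one_div_pos_of_nat
  have hθ : Tendsto θ atTop (𝓝 0) := by
    have := (tendsto_one_div_add_atTop_nhds_zero_nat (𝕜 := ℝ)).const_mul (r / 2)
    rwa [mul_zero] at this
  have hθr : ∀ k, θ k ≤ r / 2 := fun k => by
    have : 1 / ((k : ℝ) + 1) ≤ 1 := (div_le_one (by positivity)).2 (by simp)
    have h2 : 0 < r / 2 := by linarith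
    calc θ k ≤ r / 2 * 1 := mul_le_mul_of_nonneg_left this h2.le
      _ = r / 2 := mul_one _
  have hsel : ∀ k : ℕ, ∃ n, max k N ≤ n ∧
      (c : ℝ≥0∞) + c < (πn n).map Prod.fst (A n ∩ l n ⁻¹' Metric.thickening (θ k) K) := by
    intro k
    have hlt : (c : ℝ≥0∞) + c < μ (Metric.thickening (θ k) K) :=
      hcc.trans_le (measure_mono (Metric.self_subset_thickening (hθ0 k) K))
    obtain ⟨n, h1, h2⟩ := ((hc.eventually_fst_gt_of_isOpen Metric.isOpen_thickening hlt).and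
      (eventually_ge_atTop (max k N))).exists
    exact ⟨n, h2, h1⟩
  choose m hmk hmS using hsel
  have hm : Tendsto m atTop atTop :=
    tendsto_atTop_mono (fun k => (le_max_left _ _).trans (hmk k)) tendsto_id
  set S : ∀ k, Set (Y (m k)) := fun k => A (m k) ∩ l (m k) ⁻¹' Metric.thickening (θ k) K with hS
  have hSK : ∀ k, ∀ u ∈ S k, ∃ x ∈ K, dist (l (m k) u) x < θ k :=
    fun k u hu => Metric.mem_thickening_iff.1 hu.2
  have hSr : ∀ k, ∀ u ∈ S k, dist (l (m k) u) x₀ < r := by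
    intro k u hu
    obtain ⟨x, hx, hd⟩ := hSK k u hu
    have h1 := Metric.mem_closedBall.1 (hKr hx)
    have h2 := dist_triangle (l (m k) u) x x₀
    have h3 := hθr k
    linarith
  have hSρ : ∀ k, ∀ u ∈ S k, ∀ v ∈ S k, dLn (m k) u v ≤ ENNReal.ofReal ρ := fun k u hu v hv =>
    hN _ ((le_max_right _ _).trans (hmk k)) u hu.1 v hv.1 (hSr k u hu) (hSr k v hv)
  have hSρ' : ∀ k, ∀ u ∈ S k, ∀ v ∈ S k, (dLn (m k) u v).toReal ≤ ρ := fun k u hu v hv => by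
    have := ENNReal.toReal_mono ENNReal.ofReal_ne_top (hSρ k u hu v hv)
    rwa [ENNReal.toReal_ofReal hρ.le] at this
  set D : ∀ k, Y (m k) → Set ℝ := fun k v => innerDistances (dLn (m k)) (Γn (m k)) (S k) η v with hD
  have hDρ : ∀ k, ∀ v ∈ S k, D k v ⊆ Icc 0 ρ := by
    rintro k v hv _ ⟨p, -, x, hx, q, -, -, -, -, rfl, -, -⟩
    exact ⟨ENNReal.toReal_nonneg, hSρ' k x hx v hv⟩
  set F : ∀ k, Set (Y (m k)) := fun k => {v | v ∈ S k ∧ ENNReal.ofReal η < volume (D k v)} with hF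
  have hFc : ∀ k, (c : ℝ≥0∞) ≤ (πn (m k)).map Prod.fst (F k) := by
    intro k
    have h1 := hηS (m k) (S k)
      (hc.measurableSet_inter_preimage (m k) Metric.isOpen_thickening.measurableSet) ⟨ρ, hSρ' k⟩
    exact (ENNReal.add_le_add_iff_right ENNReal.coe_ne_top).1 ((hmS k).le.trans h1)
  set E := upperLimit fun k => l (m k) '' F k with hE
  have hEc : (c : ℝ≥0∞) ≤ μ E := by
    refine le_measure_upperLimit (fun M => ?_) (measure_ne_top _ _)
    by_contra! hlt
    obtain ⟨k, h1, h2⟩ := ((hm.eventually (hc.eventually_fst_lt_of_isClosed isClosed_closure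
      hlt)).and (eventually_ge_atTop M)).exists
    refine absurd ((hFc k).trans (measure_mono fun v hv => ?_)) (not_le.2 h1)
    exact ⟨hv.1.1, subset_closure (mem_iUnion₂.2 ⟨k, h2, mem_image_of_mem _ hv⟩)⟩
  set B : ℕ → Set (X × ℝ) := fun k => {b | ∃ v ∈ F k, l (m k) v = b.1 ∧ b.2 ∈ D k v} with hB
  -- `H` is closed, hence suitable for Fubini. Its slices over `E` will have length at least `η`,
  -- and all its points are pairs `(y, t)` with `y` reached from `K` in time `t`.
  set H := upperLimit B with hH
  have hHm : MeasurableSet H := (isClosed_upperLimit _).measurableSet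
  have hslice : ∀ y ∈ E, ENNReal.ofReal η ≤ volume.restrict (Ioi (0 : ℝ)) (Prod.mk y ⁻¹' H) := by
    intro y hy
    obtain ⟨j, u, hj, hu, hd⟩ := exists_seq_of_mem_upperLimit hy
    have hjt : Tendsto j atTop atTop := tendsto_atTop_mono hj tendsto_id
    have huy := tendsto_of_dist_lt hd
    choose v hvF hvu using hu
    have hL : upperLimit (fun k => D (j k) (v k)) ⊆ Prod.mk y ⁻¹' H := by
      intro t ht
      obtain ⟨i, t', hi, ht', hdt⟩ := exists_seq_of_mem_upperLimit ht
      have hit : Tendsto i atTop atTop := tendsto_atTop_mono hi tendsto_id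
      exact exists_mem_upperLimit (u := fun k => (u (i k), t' k)) (hjt.comp hit)
        (fun k => ⟨v (i k), hvF _, hvu _, ht' k⟩)
        ((huy.comp hit).prodMk_nhds (tendsto_of_dist_lt hdt))
    refine le_trans ?_ (measure_mono hL)
    -- The inner distances lie in `[0, ρ]` and may include `0`.
    rw [Measure.restrict_congr_set Ioi_ae_eq_Ici]
    refine le_measure_upperLimit (fun M => ?_) ?_
    · rw [Measure.restrict_apply' measurableSet_Ici]
      refine (hvF M).2.le.trans (measure_mono fun t ht => ?_)
      exact ⟨subset_closure (mem_iUnion₂.2 ⟨M, le_rfl, ht⟩), (hDρ _ _ (hvF M).1 ht).1⟩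
    · have hsub : closure (⋃ k ≥ 0, D (j k) (v k)) ⊆ Icc 0 ρ :=
        closure_minimal (iUnion₂_subset fun k _ => hDρ _ _ (hvF k).1) isClosed_Icc
      refine ((Measure.restrict_apply_le _ _).trans_lt ((measure_mono hsub).trans_lt ?_)).ne
      simp
  have hHsub : ∀ t, (fun y => (y, t)) ⁻¹' H ⊆
      {y | ∃ x ∈ K, (x, y) ∈ orientedRays dL Γ ∧ (dL x y).toReal = t} := by
    intro t y hy
    obtain ⟨j, b, hj, hb, hd⟩ := exists_seq_of_mem_upperLimit hy
    have hjt : Tendsto j atTop atTop := tendsto_atTop_mono hj tendsto_id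
    have hby := tendsto_of_dist_lt hd
    choose v hvF hvb hbD using hb
    refine hc.exists_mem_orientedRays hdLn hdL hΓn hΓs hf hρ hη hK hKl hlong (hm.comp hjt)
      (S := fun k => S (j k)) (fun k => inter_subset_left) (hθ.comp hjt) (fun k => hSK (j k))
      (fun k => hSρ (j k)) (fun k => (hvF k).1) hbD ?_ ((continuous_snd.tendsto _).comp hby)
    exact ((continuous_fst.tendsto _).comp hby).congr fun k => (hvb k).symm
  calc (0 : ℝ≥0∞) < ENNReal.ofReal η * c := ENNReal.mul_pos (by simpa using hη) hc0.ne'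
    _ ≤ ENNReal.ofReal η * μ E := by gcongr
    _ = ∫⁻ _ in E, ENNReal.ofReal η ∂μ := (setLIntegral_const _ _).symm
    _ ≤ ∫⁻ y in E, volume.restrict (Ioi (0 : ℝ)) (Prod.mk y ⁻¹' H) ∂μ :=
      setLIntegral_mono' (isClosed_upperLimit _).measurableSet hslice
    _ ≤ ∫⁻ y, volume.restrict (Ioi (0 : ℝ)) (Prod.mk y ⁻¹' H) ∂μ := setLIntegral_le_lintegral _ _
    _ = μ.prod (volume.restrict (Ioi (0 : ℝ))) H := (Measure.prod_apply hHm).symm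
    _ = ∫⁻ t in Ioi (0 : ℝ), μ ((fun y => (y, t)) ⁻¹' H) := Measure.prod_apply_symm hHm
    _ ≤ _ := lintegral_mono fun t => measure_mono (hHsub t)

/-- The absolute continuity of the limit along the rays of a carrier in its support, for analytic
sets and without reference to a cross section. -/
theorem ConvergesVia.lintegral_pos (hc : ConvergesVia dLn πn dL π A l)
    (hdLn : ∀ n, IsRaySpace (dLn n)) (hdL : IsRaySpace dL)
    (hΓn : ∀ n, IsMonotoneCarrier (dLn n) (πn n) (Γn n))
    (hinner : ∀ ε : ℝ≥0, 0 < ε → ∃ η : ℝ, 0 < η ∧ ∀ n, ∀ S : Set (Y n), MeasurableSet S →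
      (∃ M : ℝ, ∀ u ∈ S, ∀ v ∈ S, (dLn n u v).toReal ≤ M) →
      (πn n).map Prod.fst S ≤ (πn n).map Prod.fst {v | v ∈ S ∧
        ENNReal.ofReal η < volume (innerDistances (dLn n) (Γn n) S η v)} + ε)
    (hΓs : Γ ⊆ π.support) (hΓ : IsMonotoneCarrier dL π Γ) {B : Set X} (hB : AnalyticSet B)
    (hBT : B ⊆ transportSetE dL Γ) (hBpos : 0 < π.map Prod.fst B) :
    0 < ∫⁻ t in Ioi (0 : ℝ), π.map Prod.fst
      {y | ∃ x ∈ B, (x, y) ∈ orientedRays dL Γ ∧ (dL x y).toReal = t} := by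
  set μ := π.map Prod.fst with hμ
  have hf := hΓ.finite
  have : IsProbabilityMeasure μ := Measure.isProbabilityMeasure_map measurable_fst.aemeasurable
  have hG := analyticSet_orientedRays hdL hΓ.measurableSet
  have hGk : ∀ k : ℕ, AnalyticSet (orientedRays dL Γ ∩
      {p | 1 / ((k : ℝ) + 1) ≤ (dL p.1 p.2).toReal}) := fun k =>
    analyticSet_inter hG (measurableSet_le measurable_const
      (hdL.measurable measurable_fst measurable_snd).ennreal_toReal).analyticSet
  -- Each point of `B` has a nontrivial ray leaving or entering it, of length at least some `1 / (k
  -- + 1)`; one of these countably many pieces has positive measure.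
  have hprojpos : ∃ k : ℕ, 0 < μ (B ∩ Prod.fst '' (orientedRays dL Γ ∩
        {p | 1 / ((k : ℝ) + 1) ≤ (dL p.1 p.2).toReal})) ∨
      0 < μ (B ∩ Prod.snd '' (orientedRays dL Γ ∩
        {p | 1 / ((k : ℝ) + 1) ≤ (dL p.1 p.2).toReal})) := by
    by_contra! hcon
    refine hBpos.ne' (measure_mono_null (fun x hx => ?_) (measure_iUnion_null fun k =>
      measure_union_null (le_antisymm (hcon k).1 zero_le) (le_antisymm (hcon k).2 zero_le)))
    rcases hBT hx with ⟨w, hwx, hw⟩ | ⟨z, hzx, hz⟩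
    · obtain ⟨k, hk⟩ := exists_nat_one_div_lt
        (hdL.toReal_pos (ne_top_of_mem_orientedRays hdL hf hw) hwx)
      exact mem_iUnion.2 ⟨k, Or.inr ⟨hx, (w, x), ⟨hw, hk.le⟩, rfl⟩⟩
    · obtain ⟨k, hk⟩ := exists_nat_one_div_lt
        (hdL.toReal_pos (ne_top_of_mem_orientedRays hdL hf hz) hzx.symm)
      exact mem_iUnion.2 ⟨k, Or.inl ⟨hx, (x, z), ⟨hz, hk.le⟩, rfl⟩⟩
  obtain ⟨k, hk⟩ := hprojpos
  set ρ : ℝ := 1 / ((k : ℝ) + 1) with hρdef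
  have hρ : 0 < ρ := Nat.one_div_pos_of_nat
  obtain ⟨K₀, hK₀B, hK₀, hK₀pos, hK₀l, hlong⟩ : ∃ K₀ ⊆ B, IsCompact K₀ ∧ 0 < μ K₀ ∧
      (∀ x ∈ K₀, IsLimitPoint A l x) ∧
      ((∀ x ∈ K₀, ∃ z, (x, z) ∈ orientedRays dL Γ ∧ ρ ≤ (dL x z).toReal) ∨
      (∀ x ∈ K₀, ∃ w, (w, x) ∈ orientedRays dL Γ ∧ ρ ≤ (dL w x).toReal)) := by
    have hsupp : AnalyticSet μ.support := Measure.isClosed_support.measurableSet.analyticSet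
    have main : ∀ C : Set X, AnalyticSet C → 0 < μ (B ∩ C) → ∃ K₀ ⊆ B, IsCompact K₀ ∧ 0 < μ K₀ ∧
        (∀ x ∈ K₀, IsLimitPoint A l x) ∧ K₀ ⊆ C := by
      intro C hC hpos
      have hpos' : 0 < μ (B ∩ C ∩ μ.support) := by
        rwa [measure_inter_conull Measure.measure_compl_support]
      obtain ⟨a, ha0, ha⟩ := exists_between hpos'
      obtain ⟨K₀, hsub, hK₀, hle⟩ := exists_isCompact_le_measure_of_analyticSet
        (analyticSet_inter (analyticSet_inter hB hC) hsupp) ha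
      exact ⟨K₀, fun x hx => (hsub hx).1.1, hK₀, ha0.trans_le hle,
        fun x hx => hc.isLimitPoint_of_mem_support_fst (hsub hx).2, fun x hx => (hsub hx).1.2⟩
    rcases hk with hk | hk
    · obtain ⟨K₀, h1, h2, h3, h4, h5⟩ := main _ ((hGk k).image_of_continuous continuous_fst) hk
      refine ⟨K₀, h1, h2, h3, h4, Or.inl fun x hx => ?_⟩
      obtain ⟨⟨x, z⟩, hz, rfl⟩ := h5 hx
      exact ⟨z, hz⟩
    · obtain ⟨K₀, h1, h2, h3, h4, h5⟩ := main _ ((hGk k).image_of_continuous continuous_snd) hk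
      refine ⟨K₀, h1, h2, h3, h4, Or.inr fun x hx => ?_⟩
      obtain ⟨⟨w, x⟩, hw, rfl⟩ := h5 hx
      exact ⟨w, hw⟩
  obtain ⟨x₀, hx₀, hnhds⟩ := exists_mem_forall_mem_nhdsWithin_pos_measure hK₀pos.ne'
  -- Points `d`-close to `x₀` may be `d_L`-far from each other. Approximating points near `x₀` are
  -- not, since their distances are close to `d_L(x₀, x₀) = 0`.
  have hV : Iic (ENNReal.ofReal ρ) ∈ 𝓝 (dL x₀ x₀) := by
    rw [hdL.self]
    exact Iic_mem_nhds (by simpa using hρ)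
  obtain ⟨r, hr, N, hN⟩ := hc.exists_forall_mem (hK₀l x₀ hx₀) (hK₀l x₀ hx₀) hV
  have hpos := hnhds (K₀ ∩ Metric.closedBall x₀ (r / 2)) (inter_mem self_mem_nhdsWithin
    (mem_nhdsWithin_of_mem_nhds (Metric.closedBall_mem_nhds _ (by linarith))))
  refine (hc.lintegral_pos_of_isCompact hdLn hdL hΓn hinner hΓs hf hρ
    (hK₀.inter_right Metric.isClosed_closedBall) (fun x hx => hK₀l x hx.1) hpos
    (hlong.imp (fun h x hx => h x hx.1) (fun h x hx => h x hx.1)) hr hN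
    inter_subset_right).trans_le ?_
  refine lintegral_mono fun t => measure_mono ?_
  rintro y ⟨x, hx, hy⟩
  exact ⟨x, hK₀B hx.1, hy⟩

end Main

end RayTransport

theorem theoremT
    -- the approximating spaces and the limit space
    {Y : ℕ → Type*} [∀ n, MetricSpace (Y n)] [∀ n, PolishSpace (Y n)]
    [∀ n, MeasurableSpace (Y n)] [∀ n, BorelSpace (Y n)]
    {X : Type*} [MetricSpace X] [PolishSpace X] [MeasurableSpace X] [BorelSpace X]
    (dLn : ∀ n, Y n → Y n → ℝ≥0∞) (hdLn : ∀ n, RayTransport.IsRaySpace (dLn n))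
    (dL : X → X → ℝ≥0∞) (hdL : RayTransport.IsRaySpace dL)
    -- the plans, with mutually singular marginals along the sequence
    (πn : ∀ n, Measure (Y n × Y n)) [∀ n, IsProbabilityMeasure (πn n)]
    (hsing : ∀ n, (πn n).map Prod.fst ⟂ₘ (πn n).map Prod.snd)
    (π : Measure (X × X)) [IsProbabilityMeasure π]
    -- the monotone sets carrying the plans `πn n`, and measurable cross sections of their rays
    (Γn : ∀ n, Set (Y n × Y n))
    (hΓn : ∀ n, RayTransport.IsMonotoneCarrier (dLn n) (πn n) (Γn n))
    (fn : ∀ n, Y n → Y n)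
    (hfn : ∀ n, RayTransport.IsCrossSection (dLn n) (Γn n) (fn n))
    (hfn_meas : ∀ n, AEMeasurable (fn n)
      (((πn n).map Prod.fst).restrict (RayTransport.transportSet (dLn n) (Γn n))))
    -- the three assumptions
    (hconv : RayTransport.StructuresConverge dLn πn dL π)
    (habs : ∀ n, RayTransport.AbsContAlongRays (dLn n) (Γn n) (fn n) ((πn n).map Prod.fst))
    (hequi : RayTransport.EquiIntegrableRayDensities dLn Γn fn (fun n => (πn n).map Prod.fst)) :
    (∃ Γ ⊆ π.support, RayTransport.IsMonotoneCarrier dL π Γ) ∧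
    ∀ Γ : Set (X × X), RayTransport.IsMonotoneCarrier dL π Γ →
      (Γ ⊆ π.support ∨ π {p | p.1 = p.2} = 0) →
      ∀ f : X → X, RayTransport.IsCrossSection dL Γ f →
        RayTransport.AbsContAlongRays dL Γ f (π.map Prod.fst) := by
  obtain ⟨⟨C, hC⟩, A, l, hA, hl, hweak, hiso, hcont⟩ := hconv
  have hc : RayTransport.ConvergesVia dLn πn dL π A l := ⟨hA, hl, hweak, hiso, hcont⟩
  refine ⟨hc.exists_isMonotoneCarrier hdL (fun n => (hΓn n).concentrated)
    (fun n => (hΓn n).monotone) hC (fun n => (hdLn n).measurable measurable_fst measurable_snd), ?_⟩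
  intro Γ hΓ hcase f hf B hB hBT hBpos
  have hinner := fun (ε : ℝ≥0) (hε : 0 < ε) => RayTransport.exists_forall_measure_le_add hdLn hsing
    hΓn hfn hfn_meas habs hequi hε
  suffices 0 < ∫⁻ t in Ioi (0 : ℝ), π.map Prod.fst
      {y | ∃ x ∈ B, (x, y) ∈ RayTransport.orientedRays dL Γ ∧ (dL x y).toReal = t} from
    this.trans_le (setLIntegral_mono' measurableSet_Ioi fun t ht => measure_mono
      (RayTransport.subset_translate hdL hΓ.monotone hΓ.finite hf ht))
  rcases hcase with hΓs | hdiag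
  · exact hc.lintegral_pos hdLn hdL hΓn hinner hΓs hΓ hB.analyticSet hBT hBpos
  -- Restricting `Γ` to the support may shrink `𝒯ₑ`. Without mass on the diagonal, almost every
  -- point still starts a nontrivial pair of `Γ ∩ π.support`, so `B` can be cut down to such points;
  -- the rays obtained are also rays of `Γ`.
  · have hΓ₀ : RayTransport.IsMonotoneCarrier dL π (Γ ∩ π.support) := by
      refine ⟨fun n x y h => hΓ.monotone n x y fun i => (h i).1, fun p hp => hΓ.finite p hp.1,
        ?_, ?_⟩
      · obtain ⟨K, hmono, hK, hcK, rfl⟩ := hΓ.exhaustion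
        exact ⟨fun k => K k ∩ π.support, fun i j h => inter_subset_inter_left _ (hmono h),
          fun k => (hK k).inter_right Measure.isClosed_support,
          fun k => (hcK k).mono inter_subset_left, iUnion_inter _ _⟩
      · rw [compl_inter]
        exact measure_union_null hΓ.concentrated Measure.measure_compl_support
    have hmoved := RayTransport.ae_exists_moved hdiag hΓ₀
    have hpos : 0 < π.map Prod.fst (B ∩ {x | ∃ z, z ≠ x ∧ (x, z) ∈ Γ ∩ π.support}) := by
      rwa [measure_inter_conull hmoved]
    refine (hc.lintegral_pos hdLn hdL hΓn hinner inter_subset_right hΓ₀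
      (RayTransport.analyticSet_inter hB.analyticSet (RayTransport.analyticSet_movedSources hΓ₀))
      ?_ hpos).trans_le ?_
    · rintro x ⟨-, z, hzx, hz⟩
      exact Or.inr ⟨z, hzx, (x, z), RayTransport.subset_cycleSet hz, by simp [hdL.self]⟩
    · refine lintegral_mono fun t => measure_mono ?_
      rintro y ⟨x, hx, hG, hd⟩
      exact ⟨x, hx.1, RayTransport.orientedRays_mono inter_subset_left hG, hd⟩
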